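/- Let $n,k$ be integers with $k\ge 3$ and $n-k\ge 3$, and let $Q(x)=x^{T}Mx$ be a positive definite integral quadratic form on $\mathbb{Q}^n$, where $M$ is a symmetric integer matrix; write $B_Q(v,w)=v^{T}Mw$. Let $L\subset\mathbb{Q}^n$ be a rational subspace of dimension $k$. Its discriminant is $\mathrm{disc}_Q(L)=\det\big(B_Q(v_i,v_j)\big)_{i,j\le k}$, where $v_1,\dots,v_k$ is any $\mathbb{Z}$-basis of $L(\mathbb{Z})=L\cap\mathbb{Z}^n$. Let $H_L$ be the (Zariski) identity component of the stabilizer of $L$ in the algebraic group $\mathrm{Spin}_Q$ over $\mathbb{Q}$, which acts on $\mathbb{Q}^n$ through the covering map $\mathrm{Spin}_Q\to\mathrm{SO}_Q$. A linear algebraic group $G$ over $\mathbb{Q}$ is called strongly isotropic at a prime $p$ if for every nontrivial (Zariski) connected normal algebraic subgroup $N$ of $G$ defined over $\mathbb{Q}_p$, the group $N(\mathbb{Q}_p)$ is not compact. Let $p$ be an odd prime and assume that at least one of the following holds: 1. $p\nmid\mathrm{disc}_Q(L)$ and, in case $n-k\in\{3,4\}$, also $p\nmid\det(M)$; 2. $k\ge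 5$ and $n-k\ge 5$. Then $H_L$ is strongly isotropic at $p$. -/

import Mathlib

open Matrix

noncomputable section

namespace RationalPlane

/-! ### The Zariski topology relative to a field of definition -/

section Zariski

variable (F : Type*) {K A B : Type*} [Field F] [Field K] [Algebra F K]
  [Ring A] [Algebra F A] [Ring B] [Algebra K B] [Algebra F B]

/-- The polynomial functions on the `K`-algebra `B` with coefficients in `F`, where the `F`-structure
on `B` is given by `j : A → B` (so `B` is the extension of scalars of `A` to `K`). They are the
polynomials over `F` in the `K`-linear functionals on `B` that take values in `F` on `A`. -/
def polyFun (j : A →ₐ[F] B) : Subalgebra F (B → K) :=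
  Algebra.adjoin F {f | ∃ φ : Module.Dual K B,
    (∀ a : A, φ (j a) ∈ Set.range (algebraMap F K)) ∧ f = fun b => φ b}

/-- The `F`-Zariski topology on `B`: its closed sets are the zero loci of families of polynomial
functions with coefficients in `F`. -/
abbrev zariski (j : A →ₐ[F] B) : TopologicalSpace B :=
  TopologicalSpace.generateFrom {U | ∃ f ∈ polyFun (K := K) F j, U = {b | f b ≠ 0}}

end Zariski

/-- The usual (`K`-)Zariski topology on a `K`-algebra `B`. -/
abbrev zariskiTop (K B : Type*) [Field K] [Ring B] [Algebra K B] : TopologicalSpace B :=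
  zariski (K := K) K (AlgHom.id K B)

section ZariskiFacts

variable {K B : Type*} [Field K] [Ring B] [Algebra K B]

theorem comp_mem_polyFun (T : B →ₗ[K] B) {f : B → K}
    (hf : f ∈ polyFun (K := K) K (AlgHom.id K B)) :
    (fun b => f (T b)) ∈ polyFun (K := K) K (AlgHom.id K B) := by
  unfold polyFun at hf ⊢
  induction hf using Algebra.adjoin_induction with
  | mem f hf =>
    obtain ⟨φ, -, rfl⟩ := hf
    exact Algebra.subset_adjoin ⟨φ.comp T, fun a => ⟨_, rfl⟩, rfl⟩
  | algebraMap r => exact Subalgebra.algebraMap_mem _ r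
  | add f g _ _ hf hg => exact Subalgebra.add_mem _ hf hg
  | mul f g _ _ hf hg => exact Subalgebra.mul_mem _ hf hg

theorem continuous_zariskiTop (T : B →ₗ[K] B) :
    @Continuous B B (zariskiTop K B) (zariskiTop K B) T := by
  let _ : TopologicalSpace B := zariskiTop K B
  refine continuous_generateFrom_iff.2 ?_
  rintro _ ⟨f, hf, rfl⟩
  exact TopologicalSpace.isOpen_generateFrom_of_mem ⟨_, comp_mem_polyFun T hf, rfl⟩

end ZariskiFacts

variable {n : ℕ}

/-- The quadratic form `Q(x) = xᵀ M x` on `Rⁿ`. -/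
def form (M : Matrix (Fin n) (Fin n) ℤ) (R : Type*) [CommRing R] : QuadraticForm R (Fin n → R) :=
  (M.map (Int.cast : ℤ → R)).toQuadraticForm'

/-- The Clifford algebra of `(Q, Rⁿ)`. -/
abbrev Cl (M : Matrix (Fin n) (Fin n) ℤ) (R : Type*) [CommRing R] : Type _ :=
  CliffordAlgebra (form M R)

/-- The group of `K`-points of `Spin_Q`. -/
abbrev Spin (M : Matrix (Fin n) (Fin n) ℤ) (K : Type*) [Field K] : Type _ :=
  spinGroup (form M K)

theorem form_algebraMap (M : Matrix (Fin n) (Fin n) ℤ) (F K : Type*) [Field F] [Field K]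
    [Algebra F K] (v : Fin n → F) :
    form M K (fun i => algebraMap F K (v i)) = algebraMap F K (form M F v) := by
  simp [form, Matrix.toQuadraticForm', Matrix.toLinearMap₂'_apply, map_sum]

/-- The coordinatewise inclusion `Fⁿ → Kⁿ`. -/
def vecMap (n : ℕ) (F K : Type*) [Field F] [Field K] [Algebra F K] :
    (Fin n → F) →ₗ[F] (Fin n → K) :=
  (Algebra.linearMap F K).compLeft (Fin n)

/-- The canonical map from the Clifford algebra over `F` to the Clifford algebra over an extension
`K`, induced by `Fⁿ → Kⁿ`. -/
def clMap (M : Matrix (Fin n) (Fin n) ℤ) (F K : Type*) [Field F] [Field K] [Algebra F K] :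
    Cl M F →ₐ[F] Cl M K :=
  CliffordAlgebra.lift (form M F)
    ⟨((CliffordAlgebra.ι (form M K)).restrictScalars F).comp (vecMap n F K), fun v => by
      have h : vecMap n F K v = fun i => algebraMap F K (v i) := rfl
      rw [LinearMap.comp_apply, LinearMap.restrictScalars_apply, CliffordAlgebra.ι_sq_scalar, h,
        form_algebraMap, ← IsScalarTower.algebraMap_apply]⟩

/-! ### The groups attached to a rational subspace -/

/-- The subspace `K ⊗ L` of `Kⁿ`, for `L ⊆ ℚⁿ`. -/
def extend (K : Type*) [Field K] [Algebra ℚ K] (L : Submodule ℚ (Fin n → ℚ)) :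
    Submodule K (Fin n → K) :=
  Submodule.span K (vecMap n ℚ K '' (L : Set (Fin n → ℚ)))

/-- The action of `Spin_Q(K)` on `Kⁿ` through `Spin_Q → SO_Q`, viewed inside the Clifford algebra:
`g` acts on a vector `v` as `g v g⁻¹`. -/
def spinAct {M : Matrix (Fin n) (Fin n) ℤ} {K : Type*} [Field K] (g : Spin M K) (x : Cl M K) :
    Cl M K :=
  (g : Cl M K) * x * ((g⁻¹ : Spin M K) : Cl M K)

theorem spinAct_one {M : Matrix (Fin n) (Fin n) ℤ} {K : Type*} [Field K] (x : Cl M K) :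
    spinAct (1 : Spin M K) x = x := by
  simp [spinAct]

theorem spinAct_mul {M : Matrix (Fin n) (Fin n) ℤ} {K : Type*} [Field K] (g h : Spin M K)
    (x : Cl M K) : spinAct (g * h) x = spinAct g (spinAct h x) := by
  simp [spinAct, mul_assoc]

/-- `F_L(K)`: the stabilizer in `Spin_Q(K)` of the subspace `K ⊗ L` of `Kⁿ`. -/
def stab (M : Matrix (Fin n) (Fin n) ℤ) (L : Submodule ℚ (Fin n → ℚ)) (K : Type*) [Field K]
    [Algebra ℚ K] : Subgroup (Spin M K) where
  carrier := {g | spinAct g '' (CliffordAlgebra.ι (form M K) '' (extend K L : Set (Fin n → K)))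
    = CliffordAlgebra.ι (form M K) '' (extend K L : Set (Fin n → K))}
  one_mem' := by
    simp [Set.image, spinAct_one]
  mul_mem' := by
    intro g h hg hh
    have e : spinAct (g * h) = spinAct g ∘ spinAct h := funext (spinAct_mul g h)
    simp only [Set.mem_ofPred_eq] at hg hh ⊢
    rw [e, Set.image_comp, hh, hg]
  inv_mem' := by
    intro g hg
    simp only [Set.mem_ofPred_eq] at hg ⊢
    have e : spinAct g⁻¹ ∘ spinAct g = id := by
      funext x
      simp [← spinAct_mul, spinAct_one]
    conv_lhs => rw [← hg]
    rw [← Set.image_comp, e, Set.image_id]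

/-- The Zariski topology on `Spin_Q(K)`, as a subset of the Clifford algebra. -/
abbrev spinZariski (M : Matrix (Fin n) (Fin n) ℤ) (K : Type*) [Field K] :
    TopologicalSpace (Spin M K) :=
  (zariskiTop K (Cl M K)).induced Subtype.val

theorem continuous_mul_left_spin (M : Matrix (Fin n) (Fin n) ℤ) (K : Type*) [Field K]
    (g : Spin M K) :
    @Continuous _ _ (spinZariski M K) (spinZariski M K) (fun x => g * x) := by
  let _ : TopologicalSpace (Cl M K) := zariskiTop K (Cl M K)
  exact continuous_induced_rng.2
    ((continuous_zariskiTop (LinearMap.mulLeft K (g : Cl M K))).comp continuous_induced_dom)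

theorem continuous_inv_spin (M : Matrix (Fin n) (Fin n) ℤ) (K : Type*) [Field K] :
    @Continuous _ _ (spinZariski M K) (spinZariski M K) (fun x => x⁻¹) := by
  let _ : TopologicalSpace (Cl M K) := zariskiTop K (Cl M K)
  let T : Cl M K →ₗ[K] Cl M K :=
    { toFun := star, map_add' := star_add, map_smul' := CliffordAlgebra.star_smul }
  exact continuous_induced_rng.2 ((continuous_zariskiTop T).comp continuous_induced_dom)

/-- The Zariski identity component of a subgroup `G` of `Spin_Q(K)`. -/
def identityComponent {M : Matrix (Fin n) (Fin n) ℤ} {K : Type*} [Field K]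
    (G : Subgroup (Spin M K)) : Subgroup (Spin M K) where
  carrier := @connectedComponentIn _ (spinZariski M K) (G : Set (Spin M K)) 1
  one_mem' := @mem_connectedComponentIn _ (spinZariski M K) _ _ G.one_mem
  mul_mem' := by
    let _ : TopologicalSpace (Spin M K) := spinZariski M K
    intro a b ha hb
    have haG : a ∈ G := connectedComponentIn_subset _ _ ha
    have h1 : (fun x => a * x) '' connectedComponentIn (G : Set (Spin M K)) 1 ⊆
        connectedComponentIn (G : Set (Spin M K)) a := by
      refine (isPreconnected_connectedComponentIn.image _
        (continuous_mul_left_spin M K a).continuousOn).subset_connectedComponentIn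
        ⟨1, mem_connectedComponentIn G.one_mem, mul_one a⟩ ?_
      rintro _ ⟨x, hx, rfl⟩
      exact G.mul_mem haG (connectedComponentIn_subset _ _ hx)
    rw [connectedComponentIn_eq ha]
    exact h1 ⟨b, hb, rfl⟩
  inv_mem' := by
    let _ : TopologicalSpace (Spin M K) := spinZariski M K
    intro a ha
    have h1 : (fun x : Spin M K => x⁻¹) '' connectedComponentIn (G : Set (Spin M K)) 1 ⊆
        connectedComponentIn (G : Set (Spin M K)) 1 := by
      refine (isPreconnected_connectedComponentIn.image _
        (continuous_inv_spin M K).continuousOn).subset_connectedComponentIn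
        ⟨1, mem_connectedComponentIn G.one_mem, inv_one⟩ ?_
      rintro _ ⟨x, hx, rfl⟩
      exact G.inv_mem (connectedComponentIn_subset _ _ hx)
    exact h1 ⟨a, ha, rfl⟩

/-- `H_L(K)`: the Zariski identity component of the stabilizer of `L` in `Spin_Q`, for `K` an
algebraically closed field of characteristic zero. -/
def groupH (M : Matrix (Fin n) (Fin n) ℤ) (L : Submodule ℚ (Fin n → ℚ)) (K : Type*) [Field K]
    [Algebra ℚ K] : Subgroup (Spin M K) :=
  identityComponent (stab M L K)

/-! ### Strong isotropy -/

section Isotropy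

variable {M : Matrix (Fin n) (Fin n) ℤ}

/-- A subgroup `N` of `Spin_Q(K)`, for `K` an algebraic closure of a field `F` of characteristic
zero, is (the group of `K`-points of) an algebraic subgroup defined over `F`. -/
def IsAlgebraicOver (F : Type*) {K : Type*} [Field F] [Field K] [Algebra F K]
    (N : Subgroup (Spin M K)) : Prop :=
  @IsClosed _ (zariski (K := K) F (clMap M F K)) ((fun g : Spin M K => (g : Cl M K)) '' N)

/-- The set of `F`-points of `N`, inside the Clifford algebra over `F`. -/
def points (F : Type*) {K : Type*} [Field F] [Field K] [Algebra F K]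
    (N : Subgroup (Spin M K)) : Set (Cl M F) :=
  {a | ∃ g ∈ N, (g : Cl M K) = clMap M F K a}

/-- An algebraic subgroup `G` of `Spin_Q` (given by its points over the algebraic closure of `ℚ_p`)
is strongly isotropic at `p` if every nontrivial (Zariski) connected normal algebraic subgroup `N`
of `G` defined over `ℚ_p` has a noncompact group `N(ℚ_p)` of `ℚ_p`-points. The topology on
`N(ℚ_p)` comes from the canonical topology of the finite-dimensional `ℚ_p`-vector space
containing it. -/
def StronglyIsotropicAt (p : ℕ) [Fact p.Prime]
    (G : Subgroup (Spin M (AlgebraicClosure ℚ_[p]))) : Prop :=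
  ∀ N : Subgroup (Spin M (AlgebraicClosure ℚ_[p])),
    N ≤ G → (N.subgroupOf G).Normal → IsAlgebraicOver ℚ_[p] N →
    @IsConnected _ (spinZariski M (AlgebraicClosure ℚ_[p])) (N : Set (Spin M _)) →
    N ≠ ⊥ →
    ¬ @IsCompact (Cl M ℚ_[p]) (moduleTopology ℚ_[p] (Cl M ℚ_[p])) (points ℚ_[p] N)

end Isotropy

/-! ### The discriminant -/

/-- The lattice `L(ℤ) = L ∩ ℤⁿ`. -/
def intPoints (L : Submodule ℚ (Fin n → ℚ)) : Submodule ℤ (Fin n → ℤ) :=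
  (L.restrictScalars ℤ).comap ((Algebra.linearMap ℤ ℚ).compLeft (Fin n))

/-- The discriminant `disc_Q(L)`: the determinant of the Gram matrix of a `ℤ`-basis of `L(ℤ)` with
respect to `B_Q(v, w) = vᵀ M w`. -/
def disc (M : Matrix (Fin n) (Fin n) ℤ) (L : Submodule ℚ (Fin n → ℚ)) : ℤ :=
  Matrix.det (Matrix.of fun i j =>
    (Module.finBasis ℤ (intPoints L) i : Fin n → ℤ) ⬝ᵥ
      (M *ᵥ (Module.finBasis ℤ (intPoints L) j : Fin n → ℤ)))

/-- The discriminant does not depend on the choice of the basis. -/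
theorem disc_eq (M : Matrix (Fin n) (Fin n) ℤ) (L : Submodule ℚ (Fin n → ℚ))
    (b : Module.Basis (Fin (Module.finrank ℤ (intPoints L))) ℤ (intPoints L)) :
    Matrix.det (Matrix.of fun i j =>
      (b i : Fin n → ℤ) ⬝ᵥ (M *ᵥ (b j : Fin n → ℤ))) = disc M L := by
  set c := Module.finBasis ℤ (intPoints L) with hc
  let B : LinearMap.BilinForm ℤ (intPoints L) :=
    (Matrix.toLinearMap₂' ℤ M).compl₁₂ (intPoints L).subtype (intPoints L).subtype
  have key : ∀ d : Module.Basis (Fin (Module.finrank ℤ (intPoints L))) ℤ (intPoints L),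
      (Matrix.of fun i j => (d i : Fin n → ℤ) ⬝ᵥ (M *ᵥ (d j : Fin n → ℤ))) =
        LinearMap.BilinForm.toMatrix d B := by
    intro d
    ext i j
    rw [LinearMap.BilinForm.toMatrix_apply]
    exact (Matrix.toLinearMap₂'_apply' M _ _).symm
  have hu : IsUnit (c.toMatrix b).det := by
    rw [← Module.Basis.det_apply]
    exact c.isUnit_det b
  unfold disc
  rw [key, ← hc, key, ← LinearMap.BilinForm.toMatrix_mul_basis_toMatrix (b := c) b B, Matrix.det_mul,
    Matrix.det_mul, Matrix.det_transpose]
  rcases Int.isUnit_iff.1 hu with h | h <;> rw [h] <;> ring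

end RationalPlane

end

/-!
Let `F = ℚ_p`, let `K` be its algebraic closure, and let `L'` be the orthogonal complement of `L`
over `ℚ`. An isometry of the nondegenerate space `Kⁿ` stabilizes `L` if and only if it stabilizes
`L'`, so `H_L = H_{L'}` (`stab_eq_stab_of_orthogonal`), and everything proved for `L` holds for `L'`
too. The hypotheses on `p` are used only to show that `L` and `L'` are both isotropic over `F`:
subspaces of dimension at least five always are (`exists_isotropic_extend_of_five_le`), and the
divisibility conditions make the relevant lattices over `ℤ_p` unimodular, so that a zero modulo `p`,
which exists by Chevalley-Warning, lifts by Hensel's lemma (`exists_isotropic_of_not_dvd_disc`,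
`exists_isotropic_orthogonal`).

Let `N` be a connected normal subgroup of `H_L` defined over `F`. If some `g ∈ N` moves the line of
a rational isotropic vector `u` of `L`, then there is a torus in `H_L` under which `u` and `g u` are
eigenvectors with different eigenvalues. The commutator of `g` with an element of this torus is an
element `m` of `N` with `m u = c u` and `c ^ 2 ≠ 1`, and the commutator of `m` with `1 + u v`, for
`v` anisotropic and orthogonal to `u`, is `1 + u x` with `x = c • m v - v`. Comparing the values of
the form shows that `x` is not a multiple of `u` (`exists_unipotent_mem_of_normal`). The vectors `x`
orthogonal to `u` with `1 + u x ∈ N` form a linear subspace, since `N` is Zariski closed, and it is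
stable under the Galois group, since `N` is defined over `F`; hence `x` can be chosen rational
(`exists_rational_unipotent`). Then `N(F)` contains the line `1 + t u x` and is not compact.

Otherwise `N` preserves all rational isotropic lines of `L` and of `L'`, and therefore acts on both
spaces by scalars (`exists_scalar_of_isotropic_lines`). These scalars are `±1`, hence `1` as `N` is
connected. So `N` lies in the kernel `{±1}` of the action on vectors, and it is trivial
(`eq_bot_of_act_eq_self`). No distinction between simple and non-simple spin groups, as in dimension
four, is needed.
-/

noncomputable section

namespace RationalPlane

open CliffordAlgebra Topology

/-! ### Vectors and scalars in the Clifford algebra -/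

section Clifford

variable {K V : Type*} [Field K] [AddCommGroup V] [Module K V]
  {Q : QuadraticForm K V}

theorem ι_injective [CharZero K] : Function.Injective (ι Q) := by
  have : Invertible (2 : K) := invertibleOfNonzero two_ne_zero
  intro x y h
  have h2 := congrArg (equivExterior Q) h
  simp only [equivExterior, changeFormEquiv_apply, changeForm_ι] at h2
  exact (ExteriorAlgebra.ι_inj K x y).1 h2

theorem algebraMap_clifford_injective [CharZero K] :
    Function.Injective (algebraMap K (CliffordAlgebra Q)) := by
  have : Invertible (2 : K) := invertibleOfNonzero two_ne_zero
  intro x y h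
  have h2 := congrArg (equivExterior Q) h
  simp only [equivExterior, changeFormEquiv_apply, changeForm_algebraMap] at h2
  exact (ExteriorAlgebra.algebraMap_leftInverse V).injective h2

theorem clifford_nontrivial [CharZero K] : Nontrivial (CliffordAlgebra Q) :=
  algebraMap_clifford_injective.nontrivial

/-! ### Central elements of the even Clifford algebra -/

section Exterior

variable {κ : Type*} [Fintype κ] (b : Module.Basis κ K V)

/-- The Euler operator `∑ eᵢ ∧ (eᵢ* ⌋ ·)` of the exterior algebra, which multiplies elements of
degree `k` by `k`. -/
def euler : ExteriorAlgebra K V →ₗ[K] ExteriorAlgebra K V :=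
  ∑ i, (LinearMap.mulLeft K (ExteriorAlgebra.ι K (b i))) ∘ₗ
    (contractLeft (Q := (0 : QuadraticForm K V)) (b.coord i))

theorem euler_apply (x : ExteriorAlgebra K V) :
    euler b x = ∑ i, ExteriorAlgebra.ι K (b i) *
      contractLeft (Q := (0 : QuadraticForm K V)) (b.coord i) x := by
  simp [euler, LinearMap.sum_apply]

theorem euler_ι_mul (v : V) (x : ExteriorAlgebra K V) :
    euler b (ExteriorAlgebra.ι K v * x) =
      ExteriorAlgebra.ι K v * x + ExteriorAlgebra.ι K v * euler b x := by
  rw [euler_apply, euler_apply, Finset.mul_sum]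
  have h1 : ∀ i, ExteriorAlgebra.ι K (b i) *
      contractLeft (Q := (0 : QuadraticForm K V)) (b.coord i) (ExteriorAlgebra.ι K v * x) =
      (b.coord i v • ExteriorAlgebra.ι K (b i)) * x +
      ExteriorAlgebra.ι K v * (ExteriorAlgebra.ι K (b i) *
        contractLeft (Q := (0 : QuadraticForm K V)) (b.coord i) x) := by
    intro i
    have h := contractLeft_ι_mul (Q := (0 : QuadraticForm K V)) (b.coord i) v x
    have hs : ExteriorAlgebra.ι K (b i) * ExteriorAlgebra.ι K v =
        - (ExteriorAlgebra.ι K v * ExteriorAlgebra.ι K (b i)) :=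
      eq_neg_of_add_eq_zero_left (ExteriorAlgebra.ι_add_mul_swap _ _)
    erw [h]
    rw [mul_sub, mul_smul_comm, smul_mul_assoc, sub_eq_add_neg]
    congr 1
    erw [← mul_assoc, ← mul_assoc, hs, neg_mul, neg_neg]
  simp_rw [h1, Finset.sum_add_distrib, ← Finset.sum_mul]
  congr 2
  simp_rw [← map_smul, ← map_sum]
  congr 1
  exact b.sum_repr v

theorem euler_of_mem_pow (k : ℕ) (x : ExteriorAlgebra K V)
    (hx : x ∈ LinearMap.range (ExteriorAlgebra.ι K : V →ₗ[K] _) ^ k) :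
    euler b x = (k : K) • x := by
  induction hx using Submodule.pow_induction_on_left' with
  | algebraMap r =>
    rw [euler_apply]
    simp only [Nat.cast_zero, zero_smul]
    refine Finset.sum_eq_zero fun i _ => ?_
    erw [contractLeft_algebraMap, mul_zero]
  | add x y i hx hy h1 h2 => rw [map_add, h1, h2, smul_add]
  | mem_mul m hm i x hx h1 =>
    obtain ⟨v, rfl⟩ := hm
    rw [euler_ι_mul, h1, mul_smul_comm, Nat.cast_succ, add_smul, one_smul, add_comm]

end Exterior

/-- An element of the exterior algebra killed by all contractions is killed by the Euler operator,
and hence, in characteristic zero, has no component of positive degree. -/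
theorem exists_algebraMap_of_contractLeft_eq_zero_exterior [CharZero K] [FiniteDimensional K V]
    (x : ExteriorAlgebra K V)
    (hx : ∀ d : Module.Dual K V, contractLeft (Q := (0 : QuadraticForm K V)) d x = 0) :
    ∃ r : K, x = algebraMap K _ r := by
  classical
  let b := Module.finBasis K V
  have hT : euler b x = 0 := by
    rw [euler_apply]
    exact Finset.sum_eq_zero fun i _ => by rw [hx, mul_zero]
  let A : ℕ → Submodule K (ExteriorAlgebra K V) := fun i => ⋀[K]^i V
  let D := DirectSum.decompose A
  have hsum : ∑ i ∈ (D x).support, ((D x i : A i) : ExteriorAlgebra K V) = x :=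
    DirectSum.sum_support_decompose A x
  have hz : ∀ k : ℕ, (k : K) • ((D x k : A k) : ExteriorAlgebra K V) = 0 := by
    have h0 : ∑ i ∈ (D x).support, ((i : K) • (D x i : A i) : A i).1 = 0 := by
      rw [← hT]
      conv_rhs => rw [← hsum, map_sum]
      refine Finset.sum_congr rfl fun i _ => ?_
      rw [euler_of_mem_pow b i _ (D x i).2]
      rfl
    intro k
    by_cases hk : k ∈ (D x).support
    · have h1 := congrArg (fun y => ((D y k : A k) : ExteriorAlgebra K V)) h0
      simp only [D, DirectSum.decompose_sum, DirectSum.sum_apply, DirectSum.decompose_zero,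
        DirectSum.zero_apply, ZeroMemClass.coe_zero, AddSubmonoidClass.coe_finsetSum] at h1
      rw [Finset.sum_eq_single k] at h1
      · rw [DirectSum.decompose_of_mem_same A (Subtype.mem _)] at h1
        exact h1
      · intro j _ hj
        exact DirectSum.decompose_of_mem_ne A (Subtype.mem _) hj
      · intro h; exact absurd hk h
    · have : D x k = 0 := by simpa using hk
      rw [this]; simp
  have hx0 : x = ((D x 0 : A 0) : ExteriorAlgebra K V) := by
    conv_lhs => rw [← hsum]
    refine Finset.sum_eq_single 0 (fun k _ hk => ?_) (fun h => ?_)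
    · exact (smul_eq_zero.1 (hz k)).resolve_left (Nat.cast_ne_zero.2 hk)
    · rw [DFinsupp.notMem_support_iff.1 h]; rfl
  have h0 := (D x 0).2
  rw [← hx0] at h0
  have h0' : x ∈ (1 : Submodule K (ExteriorAlgebra K V)) := by simpa [A] using h0
  obtain ⟨r, hr⟩ := Submodule.mem_one.1 h0'
  exact ⟨r, hr.symm⟩

theorem exists_algebraMap_of_contractLeft_eq_zero [CharZero K] [FiniteDimensional K V]
    (x : CliffordAlgebra Q) (hx : ∀ d : Module.Dual K V, contractLeft d x = 0) :
    ∃ r : K, x = algebraMap K _ r := by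
  have : Invertible (2 : K) := invertibleOfNonzero two_ne_zero
  obtain ⟨r, hr⟩ := exists_algebraMap_of_contractLeft_eq_zero_exterior (equivExterior Q x)
    (fun d => by
      simp only [equivExterior, changeFormEquiv_apply]
      erw [← changeForm_contractLeft]
      rw [hx, map_zero])
  refine ⟨r, (equivExterior Q).injective ?_⟩
  rw [hr]
  simp only [equivExterior, changeFormEquiv_apply]
  erw [changeForm_algebraMap]

/-- The graded commutator with a vector `v` is the contraction with the functional `polar v`. -/
theorem ι_mul_sub_involute_mul_ι (v : V) (x : CliffordAlgebra Q) :
    ι Q v * x - involute x * ι Q v = contractLeft (QuadraticMap.polarBilin Q v) x := by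
  induction x using CliffordAlgebra.left_induction with
  | algebraMap r =>
    rw [contractLeft_algebraMap, AlgHom.commutes, Algebra.commutes, sub_self]
  | add x y hx hy => rw [map_add, map_add, ← hx, ← hy]; noncomm_ring
  | ι_mul x m hx =>
    rw [contractLeft_ι_mul, ← hx, map_mul, involute_ι]
    have h := ι_mul_ι_add_swap (Q := Q) v m
    have h2 : ι Q v * (ι Q m * x) =
        algebraMap K _ (QuadraticMap.polar Q v m) * x - ι Q m * (ι Q v * x) := by
      rw [← h]; noncomm_ring
    rw [h2, QuadraticMap.polarBilin_apply_apply, Algebra.smul_def]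
    noncomm_ring

/-- For a nondegenerate form, an even element of the Clifford algebra that commutes with all
vectors is a scalar. -/
theorem exists_algebraMap_of_even_of_commute [CharZero K] [FiniteDimensional K V]
    (hQ : ∀ v, (∀ w, QuadraticMap.polar Q v w = 0) → v = 0) (x : CliffordAlgebra Q)
    (hx : involute x = x) (hc : ∀ v, ι Q v * x = x * ι Q v) :
    ∃ r : K, x = algebraMap K _ r := by
  refine exists_algebraMap_of_contractLeft_eq_zero x fun d => ?_
  obtain ⟨v, rfl⟩ : ∃ v, QuadraticMap.polarBilin Q v = d := by
    have h1 : Function.Injective (QuadraticMap.polarBilin Q) := by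
      refine (injective_iff_map_eq_zero _).2 fun v hv => hQ v fun w => ?_
      rw [← QuadraticMap.polarBilin_apply_apply, hv, LinearMap.zero_apply]
    exact ((QuadraticMap.polarBilin Q).injective_iff_surjective_of_finrank_eq_finrank (by simp)).1
      h1 d
  rw [← ι_mul_sub_involute_mul_ι, hx, hc, sub_self]

end Clifford

/-! ### The action of the spin group on vectors -/

section SpinAction

variable {K V : Type*} [Field K] [AddCommGroup V] [Module K V] {Q : QuadraticForm K V}

theorem coe_mul_coe_inv (g : spinGroup Q) :
    (g : CliffordAlgebra Q) * ((g⁻¹ : spinGroup Q) : CliffordAlgebra Q) = 1 := by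
  rw [← Submonoid.coe_mul, mul_inv_cancel, Submonoid.coe_one]

theorem coe_inv_mul_coe (g : spinGroup Q) :
    ((g⁻¹ : spinGroup Q) : CliffordAlgebra Q) * (g : CliffordAlgebra Q) = 1 := by
  rw [← Submonoid.coe_mul, inv_mul_cancel, Submonoid.coe_one]

theorem isUnit_ι {a : V} (h : Q a ≠ 0) : IsUnit (ι Q a) := by
  have h1 : (Q a)⁻¹ • (ι Q a * ι Q a) = 1 := by
    rw [ι_sq_scalar, Algebra.algebraMap_eq_smul_one, smul_smul, inv_mul_cancel₀ h, one_smul]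
  exact ⟨⟨ι Q a, (Q a)⁻¹ • ι Q a, by rw [mul_smul_comm, h1], by rw [smul_mul_assoc, h1]⟩, rfl⟩

/-- The product of two vectors with `Q a * Q b = 1`, as an element of the spin group. -/
def vecPair (a b : V) (h : Q a * Q b = 1) : spinGroup Q :=
  ⟨ι Q a * ι Q b, by
    have ha : Q a ≠ 0 := left_ne_zero_of_mul_eq_one h
    have hb : Q b ≠ 0 := right_ne_zero_of_mul_eq_one h
    have hl : ∀ c (hc : Q c ≠ 0), (isUnit_ι hc).unit ∈ lipschitzGroup Q := fun c hc =>
      Subgroup.subset_closure ⟨c, rfl⟩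
    refine ⟨⟨⟨_, mul_mem (hl a ha) (hl b hb), rfl⟩, ?_⟩, ?_⟩
    · have key : ∀ a b : V, Q a * Q b = 1 → ι Q a * ι Q b * (ι Q b * ι Q a) = 1 := by
        intro a b h
        rw [mul_assoc, ← mul_assoc (ι Q b), ι_sq_scalar, Algebra.commutes, ← mul_assoc,
          ι_sq_scalar, ← map_mul, h, map_one]
      have hs : star (ι Q a * ι Q b) = ι Q b * ι Q a := by
        rw [star_mul, star_ι, star_ι, neg_mul_neg]
      exact Unitary.mem_iff.2 ⟨by rw [hs]; exact key b a (by rw [mul_comm, h]),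
        by rw [hs]; exact key a b h⟩
    · exact ι_mul_ι_mem_evenOdd_zero Q a b⟩

@[simp]
theorem coe_vecPair (a b : V) (h : Q a * Q b = 1) :
    (vecPair a b h : CliffordAlgebra Q) = ι Q a * ι Q b := rfl

theorem coe_vecPair_inv (a b : V) (h : Q a * Q b = 1) :
    ((vecPair a b h)⁻¹ : spinGroup Q) = (ι Q b * ι Q a : CliffordAlgebra Q) := by
  rw [← spinGroup.star_eq_inv, spinGroup.coe_star, coe_vecPair, star_mul, star_ι, star_ι,
    neg_mul_neg]

/-- The vector `a x a` of the Clifford algebra, which is `-Q a` times the reflection of `x` in the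
hyperplane orthogonal to `a`. -/
def sandwich (Q : QuadraticForm K V) (a x : V) : V := QuadraticMap.polar Q a x • a - Q a • x

theorem inv_vecPair (a b : V) (h : Q a * Q b = 1) :
    (vecPair a b h)⁻¹ = vecPair b a (by rw [mul_comm]; exact h) :=
  Subtype.ext (coe_vecPair_inv a b h)

theorem sandwich_mem {W : Submodule K V} {a x : V} (ha : a ∈ W) (hx : x ∈ W) :
    sandwich Q a x ∈ W :=
  W.sub_mem (W.smul_mem _ ha) (W.smul_mem _ hx)

theorem ι_mul_ι_of_polar_eq_zero {x y : V} (h : QuadraticMap.polar Q x y = 0) :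
    ι Q x * ι Q y = - (ι Q y * ι Q x) := by
  have := ι_mul_ι_add_swap (Q := Q) x y
  rw [h, map_zero] at this
  exact eq_neg_of_add_eq_zero_left this

theorem ι_mul_self_eq_zero {x : V} (h : Q x = 0) : ι Q x * ι Q x = 0 := by
  rw [ι_sq_scalar, h, map_zero]

/-- For `u` isotropic and `v, w` orthogonal to `u`, the elements `1 + u v` and `1 + u w` multiply
additively. -/
theorem one_add_mul_one_add {u v : V} (w : V) (hu : Q u = 0) (hv : QuadraticMap.polar Q u v = 0) :
    (1 + ι Q u * ι Q v) * (1 + ι Q u * ι Q w) = 1 + ι Q u * ι Q (v + w) := by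
  have h : ι Q u * ι Q v * (ι Q u * ι Q w) = 0 := by
    rw [ι_mul_ι_of_polar_eq_zero hv, neg_mul, mul_assoc, ← mul_assoc (ι Q u), ι_mul_self_eq_zero hu]
    simp
  rw [map_add, mul_add, add_mul, add_mul, h]
  noncomm_ring

variable [CharZero K]

theorem conj_ι_mem_range (g : spinGroup Q) (x : V) :
    (g : CliffordAlgebra Q) * ι Q x * ((g⁻¹ : spinGroup Q) : CliffordAlgebra Q) ∈
      LinearMap.range (ι Q) := by
  have : Invertible (2 : K) := invertibleOfNonzero two_ne_zero
  have h := spinGroup.conjAct_smul_ι_mem_range_ι (x := spinGroup.toUnits g) g.2 x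
  rwa [ConjAct.units_smul_def, ConjAct.ofConjAct_toConjAct] at h

/-- The action of the spin group on vectors, `v ↦ g v g⁻¹`, as a linear map of the space of vectors
itself, which embeds into the Clifford algebra. -/
def act (g : spinGroup Q) : V →ₗ[K] V :=
  (LinearEquiv.ofInjective (ι Q) ι_injective).symm.toLinearMap ∘ₗ
    LinearMap.codRestrict (LinearMap.range (ι Q))
      (LinearMap.mulLeft K (g : CliffordAlgebra Q) ∘ₗ
        LinearMap.mulRight K ((g⁻¹ : spinGroup Q) : CliffordAlgebra Q) ∘ₗ ι Q)
      (fun x => by simpa [mul_assoc] using conj_ι_mem_range g x)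

theorem ι_act (g : spinGroup Q) (x : V) :
    ι Q (act g x) =
      (g : CliffordAlgebra Q) * ι Q x * ((g⁻¹ : spinGroup Q) : CliffordAlgebra Q) := by
  have h := LinearEquiv.apply_symm_apply (LinearEquiv.ofInjective (ι Q) ι_injective)
    (⟨_, conj_ι_mem_range g x⟩ : LinearMap.range (ι Q))
  have h2 := congrArg Subtype.val h
  rw [LinearEquiv.ofInjective_apply] at h2
  refine Eq.trans ?_ h2
  simp only [act, LinearMap.comp_apply, LinearEquiv.coe_coe]
  congr 3
  exact Subtype.ext (by simp [mul_assoc])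

theorem act_eq_iff (g : spinGroup Q) (x y : V) :
    act g x = y ↔ (g : CliffordAlgebra Q) * ι Q x = ι Q y * g := by
  rw [← ι_injective.eq_iff (f := ι Q), ι_act]
  constructor
  · intro h; rw [← h, mul_assoc, coe_inv_mul_coe, mul_one]
  · intro h; rw [h, mul_assoc, coe_mul_coe_inv, mul_one]

@[simp]
theorem act_one (x : V) : act (1 : spinGroup Q) x = x := by
  simp [act_eq_iff]

theorem act_mul (g h : spinGroup Q) (x : V) : act (g * h) x = act g (act h x) := by
  rw [act_eq_iff, Submonoid.coe_mul, mul_assoc, (act_eq_iff h x _).1 rfl, ← mul_assoc,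
    (act_eq_iff g _ _).1 rfl, mul_assoc]

@[simp]
theorem act_inv_act (g : spinGroup Q) (x : V) : act g⁻¹ (act g x) = x := by
  rw [← act_mul, inv_mul_cancel, act_one]

@[simp]
theorem act_act_inv (g : spinGroup Q) (x : V) : act g (act g⁻¹ x) = x := by
  rw [← act_mul, mul_inv_cancel, act_one]

theorem map_act (g : spinGroup Q) (x : V) : Q (act g x) = Q x := by
  apply algebraMap_clifford_injective (Q := Q)
  rw [← ι_sq_scalar, ι_act, ← ι_sq_scalar]
  have h : ∀ a b c : CliffordAlgebra Q, b * a = 1 → a * c * b * (a * c * b) = a * (c * c) * b := by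
    intro a b c h
    calc _ = a * c * (b * a) * c * b := by noncomm_ring
      _ = _ := by rw [h]; noncomm_ring
  rw [h _ _ _ (coe_inv_mul_coe g), ι_sq_scalar, ← Algebra.commutes, mul_assoc, coe_mul_coe_inv,
    mul_one]

theorem polar_act (g : spinGroup Q) (x y : V) :
    QuadraticMap.polar Q (act g x) (act g y) = QuadraticMap.polar Q x y := by
  simp only [QuadraticMap.polar, ← map_add, map_act]

theorem act_vecPair (a b : V) (h : Q a * Q b = 1) (x : V) :
    act (vecPair a b h) x = sandwich Q a (sandwich Q b x) := by
  apply ι_injective (Q := Q)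
  rw [ι_act, coe_vecPair, coe_vecPair_inv, sandwich, sandwich, ← ι_mul_ι_mul_ι, ← ι_mul_ι_mul_ι]
  noncomm_ring

/-- For nondegenerate `Q`, `u v ≠ 0` in the Clifford algebra unless `v` is a multiple of `u`. -/
theorem ι_mul_ι_ne_zero (hQ : ∀ v, (∀ w, QuadraticMap.polar Q v w = 0) → v = 0) {u v : V}
    (hu : u ≠ 0) (hv : ∀ c : K, v ≠ c • u) : ι Q u * ι Q v ≠ 0 := by
  intro h0
  obtain ⟨w, hw⟩ : ∃ w, QuadraticMap.polar Q u w ≠ 0 := by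
    by_contra! h
    exact hu (hQ u h)
  have h1 : ι Q (QuadraticMap.polar Q w u • v - QuadraticMap.polar Q w v • u) = 0 := by
    rw [map_sub, map_smul, map_smul, Algebra.smul_def, Algebra.smul_def, ← ι_mul_ι_add_swap,
      Algebra.commutes, ← ι_mul_ι_add_swap]
    have h2 := congrArg (fun z => ι Q w * z) h0
    have h3 := congrArg (fun z => z * ι Q w) h0
    simp only [mul_zero, zero_mul] at h2 h3
    calc _ = ι Q w * (ι Q u * ι Q v) - ι Q u * ι Q v * ι Q w := by noncomm_ring
      _ = 0 := by rw [h2, h3, sub_zero]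
  rw [← map_zero (ι Q)] at h1
  have h2 := sub_eq_zero.1 (ι_injective h1)
  rw [QuadraticMap.polar_comm] at hw
  refine hv ((QuadraticMap.polar Q w u)⁻¹ * QuadraticMap.polar Q w v) ?_
  rw [mul_smul, ← h2, smul_smul, inv_mul_cancel₀ hw, one_smul]

end SpinAction

/-! ### Zariski topology: closed sets, curves and connectedness -/

section ZariskiClosed

variable {F K A B : Type*} [Field F] [Field K] [Algebra F K]
  [Ring A] [Algebra F A] [Ring B] [Algebra K B] [Algebra F B] {j : A →ₐ[F] B}

/-- The nonvanishing sets of polynomial functions form a basis of the Zariski topology. -/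
theorem exists_polyFun_of_isOpen {U : Set B} (hU : IsOpen[zariski (K := K) F j] U) :
    ∀ x ∈ U, ∃ f ∈ polyFun (K := K) F j, f x ≠ 0 ∧ ∀ y, f y ≠ 0 → y ∈ U := by
  induction hU with
  | basic U hU =>
    obtain ⟨f, hf, rfl⟩ := hU
    exact fun x hx => ⟨f, hf, hx, fun y hy => hy⟩
  | univ => exact fun x _ => ⟨1, one_mem _, one_ne_zero, fun y _ => Set.mem_univ y⟩
  | inter U V _ _ hU hV =>
    rintro x ⟨hxU, hxV⟩
    obtain ⟨f, hf, hfx, hfU⟩ := hU x hxU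
    obtain ⟨g, hg, hgx, hgV⟩ := hV x hxV
    exact ⟨f * g, mul_mem hf hg, mul_ne_zero hfx hgx, fun y hy =>
      ⟨hfU y (left_ne_zero_of_mul hy), hgV y (right_ne_zero_of_mul hy)⟩⟩
  | sUnion S _ h =>
    rintro x ⟨U, hU, hxU⟩
    obtain ⟨f, hf, hfx, hfU⟩ := h U hU x hxU
    exact ⟨f, hf, hfx, fun y hy => ⟨U, hU, hfU y hy⟩⟩

/-- A point at which all polynomial functions vanishing on a closed set vanish lies in that set. -/
theorem mem_of_isClosed_zariski {S : Set B} (hS : IsClosed[zariski (K := K) F j] S) {x : B}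
    (hx : ∀ f ∈ polyFun (K := K) F j, (∀ y ∈ S, f y = 0) → f x = 0) : x ∈ S := by
  by_contra hxS
  obtain ⟨f, hf, hfx, hfS⟩ := exists_polyFun_of_isOpen hS.isOpen_compl x hxS
  exact hfx (hx f hf fun y hy => by_contra fun h => hfS y h hy)

/-- A polynomial function restricts to a Laurent polynomial on a curve `t ↦ a + t b + t⁻¹ c`. -/
theorem exists_polynomial_of_mem_polyFun {f : B → K} (hf : f ∈ polyFun (K := K) F j)
    (a b c : B) : ∃ (P : Polynomial K) (N : ℕ), ∀ t : K, t ≠ 0 →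
      f (a + t • b + t⁻¹ • c) * t ^ N = P.eval t := by
  unfold polyFun at hf
  induction hf using Algebra.adjoin_induction with
  | mem f hf =>
    obtain ⟨φ, -, rfl⟩ := hf
    refine ⟨.C (φ a) * .X + .C (φ b) * .X ^ 2 + .C (φ c), 1, fun t ht => ?_⟩
    simp
    field_simp
  | algebraMap r =>
    exact ⟨.C (algebraMap F K r), 0, fun t ht => by simp⟩
  | add f g _ _ hf hg =>
    obtain ⟨P, m, hP⟩ := hf
    obtain ⟨R, k, hR⟩ := hg
    refine ⟨P * .X ^ k + R * .X ^ m, m + k, fun t ht => ?_⟩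
    simp only [Polynomial.eval_add, Polynomial.eval_mul, Polynomial.eval_pow, Polynomial.eval_X,
      ← hP t ht, ← hR t ht, Pi.add_apply]
    ring
  | mul f g _ _ hf hg =>
    obtain ⟨P, m, hP⟩ := hf
    obtain ⟨R, k, hR⟩ := hg
    refine ⟨P * R, m + k, fun t ht => ?_⟩
    simp only [Polynomial.eval_mul, ← hP t ht, ← hR t ht, Pi.mul_apply]
    ring

end ZariskiClosed

section SpinZariski

variable {n : ℕ} {M : Matrix (Fin n) (Fin n) ℤ} {K : Type*} [Field K]

theorem isClosed_setOf_linearMap_eq (S : Cl M K →ₗ[K] Cl M K) (a : Cl M K) :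
    IsClosed[spinZariski M K] {g : Spin M K | S (g : Cl M K) = a} := by
  have h1 : {g : Spin M K | S (g : Cl M K) = a}ᶜ =
      Subtype.val ⁻¹' (⋃ φ : Module.Dual K (Cl M K), {x | φ (S x) - φ a ≠ 0}) := by
    ext g
    simp only [Set.mem_compl_iff, Set.mem_ofPred_eq, Set.mem_preimage, Set.mem_iUnion]
    rw [← sub_eq_zero, ← Module.forall_dual_apply_eq_zero_iff K]
    push Not
    simp only [map_sub]
  refine (@isOpen_compl_iff _ _ (spinZariski M K)).1 ?_
  rw [h1]
  refine ⟨_, ?_, rfl⟩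
  refine @isOpen_iUnion _ _ (zariskiTop K (Cl M K)) _ fun φ => ?_
  refine TopologicalSpace.isOpen_generateFrom_of_mem ⟨fun x => φ (S x) - φ a, ?_, rfl⟩
  exact sub_mem (Algebra.subset_adjoin ⟨φ.comp S, fun a => ⟨_, rfl⟩, rfl⟩)
    (Subalgebra.algebraMap_mem _ (φ a))

/-- On a Zariski connected subgroup on which one of two linear equations, which have no common
solution there, holds at each point, the equation satisfied by `1` holds identically. -/
theorem linearMap_eq_of_isConnected {N : Subgroup (Spin M K)}
    (hN : @IsConnected _ (spinZariski M K) (N : Set (Spin M K)))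
    (S T : Cl M K →ₗ[K] Cl M K) (a b : Cl M K)
    (hST : ∀ g ∈ N, S (g : Cl M K) = a ∨ T (g : Cl M K) = b)
    (hne : ∀ g ∈ N, S (g : Cl M K) = a → T (g : Cl M K) ≠ b) (h1 : S 1 = a) :
    ∀ g ∈ N, S (g : Cl M K) = a := by
  intro g hg
  by_contra h
  let _ : TopologicalSpace (Spin M K) := spinZariski M K
  obtain ⟨x, hx, hxS, hxT⟩ := isPreconnected_closed_iff.1 hN.isPreconnected _ _
    (isClosed_setOf_linearMap_eq S a) (isClosed_setOf_linearMap_eq T b)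
    (fun x hx => hST x hx) ⟨1, N.one_mem, h1⟩ ⟨g, hg, (hST g hg).resolve_left h⟩
  exact hne x hx hxS hxT

/-- A curve `t ↦ a + t b + t⁻¹ c` in a subgroup `G`, through `1`, lies in the identity component
of `G`. -/
theorem mem_identityComponent_of_curve [Infinite K] {G : Subgroup (Spin M K)} (a b c : Cl M K)
    (γ : Kˣ → Spin M K)
    (hγ : ∀ t : Kˣ, (γ t : Cl M K) = a + (t : K) • b + (t : K)⁻¹ • c) (h1 : γ 1 = 1)
    (hG : ∀ t, γ t ∈ G) (t : Kˣ) : γ t ∈ identityComponent G := by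
  let _ : TopologicalSpace (Spin M K) := spinZariski M K
  have hirr : IsPreirreducible (Set.range γ) := by
    rintro _ _ ⟨U, hU, rfl⟩ ⟨U', hU', rfl⟩ ⟨_, ⟨s, rfl⟩, hs⟩ ⟨_, ⟨s', rfl⟩, hs'⟩
    obtain ⟨f, hf, hfs, hfU⟩ := exists_polyFun_of_isOpen (j := AlgHom.id K (Cl M K)) hU _ hs
    obtain ⟨f', hf', hfs', hfU'⟩ := exists_polyFun_of_isOpen (j := AlgHom.id K (Cl M K)) hU' _ hs'
    obtain ⟨P, N, hP⟩ := exists_polynomial_of_mem_polyFun hf a b c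
    obtain ⟨P', N', hP'⟩ := exists_polynomial_of_mem_polyFun hf' a b c
    have hne : P * P' * .X ≠ 0 := by
      refine mul_ne_zero (mul_ne_zero ?_ ?_) Polynomial.X_ne_zero
      · rintro rfl
        have := hP s s.ne_zero
        rw [← hγ, Polynomial.eval_zero] at this
        exact mul_ne_zero hfs (pow_ne_zero _ s.ne_zero) this
      · rintro rfl
        have := hP' s' s'.ne_zero
        rw [← hγ, Polynomial.eval_zero] at this
        exact mul_ne_zero hfs' (pow_ne_zero _ s'.ne_zero) this
    obtain ⟨r, hr⟩ : ∃ r, (P * P' * .X).eval r ≠ 0 := by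
      by_contra! h
      exact hne (Polynomial.funext fun r => by rw [h, Polynomial.eval_zero])
    simp only [Polynomial.eval_mul, Polynomial.eval_X] at hr
    have hr0 : r ≠ 0 := right_ne_zero_of_mul hr
    have hrP := left_ne_zero_of_mul hr
    rw [← hP r hr0, ← hP' r hr0] at hrP
    have e := hγ (Units.mk0 r hr0)
    rw [Units.val_mk0] at e
    rw [← e] at hrP
    exact ⟨_, ⟨Units.mk0 r hr0, rfl⟩, hfU _ (left_ne_zero_of_mul (left_ne_zero_of_mul hrP)),
      hfU' _ (left_ne_zero_of_mul (right_ne_zero_of_mul hrP))⟩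
  exact hirr.isPreconnected.subset_connectedComponentIn ⟨1, h1⟩
    (Set.range_subset_iff.2 hG) ⟨t, rfl⟩

end SpinZariski

/-! ### The form in coordinates -/

theorem form_apply {n : ℕ} (M : Matrix (Fin n) (Fin n) ℤ) (R : Type*) [CommRing R]
    (x : Fin n → R) : form M R x = x ⬝ᵥ (M.map (Int.cast : ℤ → R) *ᵥ x) := by
  rw [← Matrix.toLinearMap₂'_apply']
  rfl

theorem polar_form {n : ℕ} {M : Matrix (Fin n) (Fin n) ℤ} (hsymm : M.IsSymm) (R : Type*)
    [CommRing R] (x y : Fin n → R) :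
    QuadraticMap.polar (form M R) x y = 2 * (x ⬝ᵥ (M.map (Int.cast : ℤ → R) *ᵥ y)) := by
  have hs : (M.map (Int.cast : ℤ → R))ᵀ = M.map (Int.cast : ℤ → R) := by
    rw [← Matrix.transpose_map, hsymm]
  have h : y ⬝ᵥ (M.map (Int.cast : ℤ → R) *ᵥ x) = x ⬝ᵥ (M.map (Int.cast : ℤ → R) *ᵥ y) := by
    rw [Matrix.dotProduct_mulVec, ← Matrix.mulVec_transpose, hs, dotProduct_comm]
  rw [QuadraticMap.polar, form_apply, form_apply, form_apply, Matrix.mulVec_add,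
    add_dotProduct, dotProduct_add, dotProduct_add, h]
  ring

theorem eq_zero_of_forall_polar_form_eq_zero {n : ℕ} {M : Matrix (Fin n) (Fin n) ℤ}
    (hsymm : M.IsSymm) (hM : M.det ≠ 0) (E : Type*) [Field E] [CharZero E] {v : Fin n → E}
    (hv : ∀ w, QuadraticMap.polar (form M E) v w = 0) : v = 0 := by
  refine Matrix.eq_zero_of_vecMul_eq_zero (M := M.map (Int.cast : ℤ → E)) ?_ ?_
  · have h1 : (M.map (Int.cast : ℤ → E)).det = (M.det : E) := (Int.cast_det M).symm
    rw [h1]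
    exact Int.cast_ne_zero.2 hM
  · refine dotProduct_eq_zero _ fun w => ?_
    have h1 := hv w
    rw [polar_form hsymm] at h1
    rw [← Matrix.dotProduct_mulVec]
    exact (mul_eq_zero.1 h1).resolve_left two_ne_zero

/-! ### Extension of scalars -/

section Extend

variable {n : ℕ} {M : Matrix (Fin n) (Fin n) ℤ}

theorem polar_vecMap (M : Matrix (Fin n) (Fin n) ℤ) {F K : Type*} [Field F] [Field K] [Algebra F K]
    (x y : Fin n → F) :
    QuadraticMap.polar (form M K) (vecMap n F K x) (vecMap n F K y) =
      algebraMap F K (QuadraticMap.polar (form M F) x y) := by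
  simp only [QuadraticMap.polar, ← map_add, map_sub]
  exact congrArg₂ _ (congrArg₂ _ (form_algebraMap M F K _) (form_algebraMap M F K _))
    (form_algebraMap M F K _)

theorem form_vecMap (M : Matrix (Fin n) (Fin n) ℤ) {F K : Type*} [Field F] [Field K] [Algebra F K]
    (x : Fin n → F) : form M K (vecMap n F K x) = algebraMap F K (form M F x) :=
  form_algebraMap M F K x

theorem vecMap_injective (n : ℕ) (F K : Type*) [Field F] [Field K] [Algebra F K] :
    Function.Injective (vecMap n F K) := fun _ _ h =>
  funext fun i => (algebraMap F K).injective (congrFun h i)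

theorem vecMap_smul {F K : Type*} [Field F] [Field K] [Algebra F K] (c : F) (x : Fin n → F) :
    vecMap n F K (c • x) = algebraMap F K c • vecMap n F K x := by
  rw [map_smul, algebraMap_smul]

theorem vecMap_mem_extend (K : Type*) [Field K] [Algebra ℚ K] {L : Submodule ℚ (Fin n → ℚ)}
    {x : Fin n → ℚ} (hx : x ∈ L) : vecMap n ℚ K x ∈ extend K L :=
  Submodule.subset_span ⟨x, hx, rfl⟩

theorem vecMap_mem_extend_extend {F K : Type*} [Field F] [Field K] [Algebra F K] [Algebra ℚ F]
    [Algebra ℚ K] {L : Submodule ℚ (Fin n → ℚ)} {x : Fin n → F} (hx : x ∈ extend F L) :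
    vecMap n F K x ∈ extend K L := by
  induction hx using Submodule.span_induction with
  | mem x hx =>
    obtain ⟨y, hy, rfl⟩ := hx
    have e : vecMap n F K (vecMap n ℚ F y) = vecMap n ℚ K y := by
      funext i
      simp [vecMap]
    rw [e]
    exact vecMap_mem_extend K hy
  | zero => rw [map_zero]; exact Submodule.zero_mem _
  | add x y _ _ hx hy => rw [map_add]; exact Submodule.add_mem _ hx hy
  | smul c x _ hx => rw [vecMap_smul]; exact Submodule.smul_mem _ _ hx

theorem extend_le_span_vecMap (F : Type*) {K : Type*} [Field F] [Field K] [Algebra F K]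
    [Algebra ℚ F] [Algebra ℚ K] (L : Submodule ℚ (Fin n → ℚ)) :
    extend K L ≤ Submodule.span K (vecMap n F K '' (extend F L : Set (Fin n → F))) := by
  refine Submodule.span_mono ?_
  rintro _ ⟨y, hy, rfl⟩
  refine ⟨vecMap n ℚ F y, vecMap_mem_extend F hy, ?_⟩
  funext i
  simp [vecMap]

/-- Linear independence is preserved by extension of scalars: a left inverse over `F` of the map
`c ↦ ∑ cᵢ vᵢ` has a matrix with entries in `F`, which is also a left inverse over `K`. -/
theorem linearIndependent_vecMap {F K : Type*} [Field F] [Field K] [Algebra F K] {κ : Type*}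
    [Fintype κ] {v : κ → Fin n → F} (hv : LinearIndependent F v) :
    LinearIndependent K (fun i => vecMap n F K (v i)) := by
  classical
  obtain ⟨g, hg⟩ := LinearMap.exists_leftInverse_of_injective (Fintype.linearCombination F v)
    (LinearMap.ker_eq_bot.2 hv.fintypeLinearCombination_injective)
  have hgv : ∀ i k, ∑ l, v i l * g (Pi.single l 1) k = if k = i then 1 else 0 := by
    intro i k
    have h1 := congrFun (LinearMap.congr_fun hg (Pi.single i 1)) k
    rw [LinearMap.comp_apply, Fintype.linearCombination_apply_single, one_smul,
      LinearMap.id_apply, Pi.single_apply] at h1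
    rw [← h1]
    conv_rhs => rw [pi_eq_sum_univ (v i), map_sum, Finset.sum_apply]
    refine Finset.sum_congr rfl fun l _ => ?_
    rw [map_smul, Pi.smul_apply, smul_eq_mul]
    have e : (Pi.single l 1 : Fin n → F) = fun j => if l = j then 1 else 0 := by
      ext m; simp [Pi.single_apply, eq_comm]
    rw [e]
  refine Fintype.linearIndependent_iff.2 fun c hc k => ?_
  have h2 : ∑ i, c i * ∑ l, algebraMap F K (v i l) * algebraMap F K (g (Pi.single l 1) k) = 0 := by
    calc _ = ∑ l, (∑ i, c i • vecMap n F K (v i)) l * algebraMap F K (g (Pi.single l 1) k) := by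
          simp only [Finset.mul_sum, Finset.sum_apply, Finset.sum_mul, Pi.smul_apply, smul_eq_mul]
          rw [Finset.sum_comm]
          exact Finset.sum_congr rfl fun _ _ => Finset.sum_congr rfl fun _ _ =>
            (mul_assoc _ _ _).symm
      _ = 0 := by rw [hc]; simp
  simpa [← map_mul, ← map_sum, hgv] using h2

theorem finrank_le_finrank_extend (K : Type*) [Field K] [Algebra ℚ K]
    (L : Submodule ℚ (Fin n → ℚ)) :
    Module.finrank ℚ L ≤ Module.finrank K (extend K L) := by
  let b := Module.finBasis ℚ L
  have h1 : LinearIndependent ℚ (fun i => (b i : Fin n → ℚ)) :=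
    b.linearIndependent.map' L.subtype (Submodule.ker_subtype L)
  have h2 := linearIndependent_vecMap (K := K) h1
  have h3 : LinearIndependent K (fun i => (⟨vecMap n ℚ K (b i), vecMap_mem_extend K (b i).2⟩ :
      extend K L)) :=
    LinearIndependent.of_comp (extend K L).subtype h2
  simpa using h3.fintype_card_le_finrank

theorem extend_orthogonal (K : Type*) [Field K] [Algebra ℚ K] {L L' : Submodule ℚ (Fin n → ℚ)}
    (h : ∀ x ∈ L, ∀ y ∈ L', QuadraticMap.polar (form M ℚ) x y = 0) :
    ∀ x ∈ extend K L, ∀ y ∈ extend K L', QuadraticMap.polar (form M K) x y = 0 := by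
  intro x hx y hy
  induction hx using Submodule.span_induction with
  | mem x hx =>
    induction hy using Submodule.span_induction with
    | mem y hy =>
      obtain ⟨x, hx, rfl⟩ := hx
      obtain ⟨y, hy, rfl⟩ := hy
      rw [polar_vecMap, h x hx y hy, map_zero]
    | zero => simp
    | add y z _ _ hy hz => rw [QuadraticMap.polar_add_right, hy, hz, add_zero]
    | smul c y _ hy => rw [QuadraticMap.polar_smul_right, hy, smul_zero]
  | zero => simp
  | add x z _ _ hx hz => rw [QuadraticMap.polar_add_left, hx, hz, add_zero]
  | smul c x _ hx => rw [QuadraticMap.polar_smul_left, hx, smul_zero]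

theorem extend_sup_eq_top (K : Type*) [Field K] [Algebra ℚ K] {L L' : Submodule ℚ (Fin n → ℚ)}
    (h : L ⊔ L' = ⊤) : extend K L ⊔ extend K L' = ⊤ := by
  have h1 : ∀ i, (Pi.single i 1 : Fin n → K) ∈ extend K L ⊔ extend K L' := by
    intro i
    have h2 : (Pi.single i 1 : Fin n → ℚ) ∈ L ⊔ L' := h ▸ Submodule.mem_top
    obtain ⟨x, hx, y, hy, e⟩ := Submodule.mem_sup.1 h2
    have e2 : (Pi.single i 1 : Fin n → K) = vecMap n ℚ K x + vecMap n ℚ K y := by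
      rw [← map_add, e]
      funext k
      by_cases hk : k = i
      · subst hk; simp [vecMap]
      · simp [vecMap, hk]
    rw [e2]
    exact Submodule.add_mem_sup (vecMap_mem_extend K hx) (vecMap_mem_extend K hy)
  rw [eq_top_iff]
  intro x _
  rw [pi_eq_sum_univ' x]
  refine Submodule.sum_mem _ fun i _ => Submodule.smul_mem _ _ ?_
  exact h1 i

end Extend

/-! ### The stabilizer of a rational subspace -/

section Stab

variable {n : ℕ} {M : Matrix (Fin n) (Fin n) ℤ} {K : Type*} [Field K]

/-- A vector orthogonal to a summand of an orthogonal decomposition of a nondegenerate space lies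
in the other summand. -/
theorem mem_of_forall_polar_eq_zero {W W' : Submodule K (Fin n → K)}
    (hQ : ∀ v, (∀ w, QuadraticMap.polar (form M K) v w = 0) → v = 0)
    (ho : ∀ x ∈ W, ∀ y ∈ W', QuadraticMap.polar (form M K) x y = 0) (ht : W ⊔ W' = ⊤)
    {x : Fin n → K} (hx : ∀ y ∈ W', QuadraticMap.polar (form M K) x y = 0) : x ∈ W := by
  obtain ⟨a, ha, b, hb, rfl⟩ := Submodule.mem_sup.1 (ht ▸ Submodule.mem_top : x ∈ W ⊔ W')
  have hb0 : b = 0 := by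
    refine hQ b fun w => ?_
    obtain ⟨c, hc, d, hd, rfl⟩ := Submodule.mem_sup.1 (ht ▸ Submodule.mem_top : w ∈ W ⊔ W')
    have h1 := hx d hd
    rw [QuadraticMap.polar_add_left, ho a ha d hd, zero_add] at h1
    rw [QuadraticMap.polar_add_right, h1, QuadraticMap.polar_comm, ho c hc b hb, add_zero]
  rw [hb0, add_zero]
  exact ha

/-- A subspace of a nondegenerate space that has an orthogonal complement is nondegenerate. -/
theorem eq_zero_of_forall_polar_eq_zero {W W' : Submodule K (Fin n → K)}
    (hQ : ∀ v, (∀ w, QuadraticMap.polar (form M K) v w = 0) → v = 0)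
    (ho : ∀ x ∈ W, ∀ y ∈ W', QuadraticMap.polar (form M K) x y = 0) (ht : W ⊔ W' = ⊤)
    {x : Fin n → K} (hx : x ∈ W) (h : ∀ y ∈ W, QuadraticMap.polar (form M K) x y = 0) : x = 0 := by
  refine hQ x fun w => ?_
  obtain ⟨c, hc, d, hd, rfl⟩ := Submodule.mem_sup.1 (ht ▸ Submodule.mem_top : w ∈ W ⊔ W')
  rw [QuadraticMap.polar_add_right, h c hc, ho x hx d hd, add_zero]

variable [Algebra ℚ K] {L L' : Submodule ℚ (Fin n → ℚ)}

theorem mem_stab_iff [CharZero K] {g : Spin M K} :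
    g ∈ stab M L K ↔ (∀ x ∈ extend K L, act g x ∈ extend K L) ∧
      ∀ x ∈ extend K L, act g⁻¹ x ∈ extend K L := by
  have e : spinAct g '' (ι (form M K) '' (extend K L : Set (Fin n → K))) =
      ι (form M K) '' (act g '' (extend K L : Set (Fin n → K))) := by
    rw [Set.image_image, Set.image_image]
    exact Set.image_congr fun x _ => (ι_act g x).symm
  change spinAct g '' (ι (form M K) '' (extend K L : Set (Fin n → K))) = _ ↔ _
  rw [e, (Set.image_injective.2 ι_injective).eq_iff]
  constructor
  · intro h
    refine ⟨fun x hx => h.subset (Set.mem_image_of_mem _ hx), fun x hx => ?_⟩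
    rw [← SetLike.mem_coe, ← h] at hx
    obtain ⟨y, hy, rfl⟩ := hx
    rwa [act_inv_act]
  · rintro ⟨h1, h2⟩
    refine Set.Subset.antisymm (Set.image_subset_iff.2 h1) fun x hx => ?_
    exact ⟨_, h2 x hx, act_act_inv g x⟩

theorem vecPair_mem_stab [CharZero K] {a b : Fin n → K} (ha : a ∈ extend K L)
    (hb : b ∈ extend K L) (h : form M K a * form M K b = 1) : vecPair a b h ∈ stab M L K := by
  refine mem_stab_iff.2 ⟨fun x hx => ?_, fun x hx => ?_⟩
  · rw [act_vecPair]; exact sandwich_mem ha (sandwich_mem hb hx)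
  · rw [inv_vecPair, act_vecPair]; exact sandwich_mem hb (sandwich_mem ha hx)

theorem stab_le_stab_of_orthogonal [CharZero K]
    (hQ : ∀ v, (∀ w, QuadraticMap.polar (form M K) v w = 0) → v = 0)
    (ho : ∀ x ∈ L, ∀ y ∈ L', QuadraticMap.polar (form M ℚ) x y = 0) (ht : L ⊔ L' = ⊤) :
    stab M L K ≤ stab M L' K := by
  have key : ∀ g ∈ stab M L K, ∀ x ∈ extend K L', act g x ∈ extend K L' := by
    intro g hg x hx
    have ho' := extend_orthogonal K ho
    refine mem_of_forall_polar_eq_zero (W' := extend K L) hQ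
      (fun x hx y hy => (QuadraticMap.polar_comm _ _ _).trans (ho' y hy x hx))
      (by rw [sup_comm]; exact extend_sup_eq_top K ht) fun y hy => ?_
    rw [← act_act_inv g y, polar_act, QuadraticMap.polar_comm]
    exact ho' _ ((mem_stab_iff.1 hg).2 y hy) x hx
  exact fun g hg => mem_stab_iff.2 ⟨key g hg, key g⁻¹ (inv_mem hg)⟩

theorem stab_eq_stab_of_orthogonal [CharZero K]
    (hQ : ∀ v, (∀ w, QuadraticMap.polar (form M K) v w = 0) → v = 0)
    (ho : ∀ x ∈ L, ∀ y ∈ L', QuadraticMap.polar (form M ℚ) x y = 0) (ht : L ⊔ L' = ⊤) :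
    stab M L K = stab M L' K :=
  le_antisymm (stab_le_stab_of_orthogonal hQ ho ht) (stab_le_stab_of_orthogonal hQ
    (fun x hx y hy => (QuadraticMap.polar_comm _ _ _).trans (ho y hy x hx)) (by rw [sup_comm, ht]))

end Stab

/-! ### Hyperbolic pairs -/

section Hyperbolic

variable {K V : Type*} [Field K] [AddCommGroup V] [Module K V] {Q : QuadraticForm K V}

/-- An isotropic vector `u` not orthogonal to `a` is part of a hyperbolic pair in the span of
`u` and `a`. -/
theorem exists_hyperbolic_partner {W : Submodule K V} {u a : V} (hu : u ∈ W) (ha : a ∈ W)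
    (hQu : Q u = 0) (hua : QuadraticMap.polar Q u a = 1) :
    ∃ c : K, a - c • u ∈ W ∧ Q (a - c • u) = 0 ∧ QuadraticMap.polar Q u (a - c • u) = 1 := by
  have huu : QuadraticMap.polar Q u u = 0 := by rw [QuadraticMap.polar_self, hQu, smul_zero]
  refine ⟨Q a, W.sub_mem ha (W.smul_mem _ hu), ?_, ?_⟩
  · rw [sub_eq_add_neg, ← neg_smul, QuadraticMap.map_add Q, QuadraticMap.map_smul, hQu,
      QuadraticMap.polar_smul_right, QuadraticMap.polar_comm, hua]
    simp
  · rw [QuadraticMap.polar_sub_right, QuadraticMap.polar_smul_right, huu, hua]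
    simp

/-- In a nondegenerate space of dimension at least three, an isotropic vector is part of a
hyperbolic pair, whose orthogonal complement contains an anisotropic vector. -/
theorem exists_hyperbolic_triple [FiniteDimensional K V] {W : Submodule K V}
    (hW : ∀ x ∈ W, (∀ y ∈ W, QuadraticMap.polar Q x y = 0) → x = 0)
    (hd : 3 ≤ Module.finrank K W) {u : V} (hu : u ∈ W) (hu0 : u ≠ 0) (hQu : Q u = 0) :
    ∃ f ∈ W, ∃ w ∈ W, Q f = 0 ∧ QuadraticMap.polar Q u f = 1 ∧ QuadraticMap.polar Q u w = 0 ∧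
      QuadraticMap.polar Q f w = 0 ∧ Q w ≠ 0 := by
  obtain ⟨a, ha, hua⟩ : ∃ a ∈ W, QuadraticMap.polar Q u a ≠ 0 := by
    by_contra! h
    exact hu0 (hW u hu h)
  obtain ⟨c, hf, hQf, huf⟩ := exists_hyperbolic_partner (a := (QuadraticMap.polar Q u a)⁻¹ • a) hu
    (W.smul_mem _ ha) hQu (by
      rw [QuadraticMap.polar_smul_right, smul_eq_mul, inv_mul_cancel₀ hua])
  set f := (QuadraticMap.polar Q u a)⁻¹ • a - c • u
  have huu : QuadraticMap.polar Q u u = 0 := by rw [QuadraticMap.polar_self, hQu, smul_zero]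
  have hff : QuadraticMap.polar Q f f = 0 := by rw [QuadraticMap.polar_self, hQf, smul_zero]
  have hfu : QuadraticMap.polar Q f u = 1 := by rw [QuadraticMap.polar_comm, huf]
  -- a nonzero vector of `W` orthogonal to the hyperbolic pair
  obtain ⟨x, hx, hx0, hux, hfx⟩ : ∃ x ∈ W, x ≠ 0 ∧ QuadraticMap.polar Q u x = 0 ∧
      QuadraticMap.polar Q f x = 0 := by
    let T : W →ₗ[K] K × K := ((QuadraticMap.polarBilin Q u).prod (QuadraticMap.polarBilin Q f)) ∘ₗ
      W.subtype
    have hT : LinearMap.ker T ≠ ⊥ := LinearMap.ker_ne_bot_of_finrank_lt (by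
      rw [Module.finrank_prod, Module.finrank_self]; omega)
    obtain ⟨x, hx, hx0⟩ := Submodule.exists_mem_ne_zero_of_ne_bot hT
    have h1 : T x = 0 := hx
    exact ⟨x, x.2, fun h => hx0 (Subtype.ext h), congrArg Prod.fst h1, congrArg Prod.snd h1⟩
  obtain ⟨y, hy, hxy⟩ : ∃ y ∈ W, QuadraticMap.polar Q x y ≠ 0 := by
    by_contra! h
    exact hx0 (hW x hx h)
  set z := y - QuadraticMap.polar Q f y • u - QuadraticMap.polar Q u y • f with hz
  have hzW : z ∈ W := W.sub_mem (W.sub_mem hy (W.smul_mem _ hu)) (W.smul_mem _ hf)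
  have huz : QuadraticMap.polar Q u z = 0 := by
    simp [hz, QuadraticMap.polar_sub_right, QuadraticMap.polar_smul_right, huu, huf]
  have hfz : QuadraticMap.polar Q f z = 0 := by
    simp [hz, QuadraticMap.polar_sub_right, QuadraticMap.polar_smul_right, hfu, hff]
  have hxz : QuadraticMap.polar Q x z = QuadraticMap.polar Q x y := by
    rw [hz, QuadraticMap.polar_sub_right, QuadraticMap.polar_sub_right,
      QuadraticMap.polar_smul_right, QuadraticMap.polar_smul_right, QuadraticMap.polar_comm Q x u,
      QuadraticMap.polar_comm Q x f, hux, hfx]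
    simp
  by_cases h1 : Q x = 0
  · by_cases h2 : Q z = 0
    · refine ⟨f, hf, x + z, W.add_mem hx hzW, hQf, huf, ?_, ?_, ?_⟩
      · rw [QuadraticMap.polar_add_right, hux, huz, add_zero]
      · rw [QuadraticMap.polar_add_right, hfx, hfz, add_zero]
      · rw [QuadraticMap.map_add Q, h1, h2, hxz]
        simpa using hxy
    · exact ⟨f, hf, z, hzW, hQf, huf, huz, hfz, h2⟩
  · exact ⟨f, hf, x, hx, hQf, huf, hux, hfx, h1⟩

/-- Two independent orthogonal isotropic vectors in a nondegenerate space: one of them has a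
hyperbolic partner orthogonal to the other. -/
theorem exists_hyperbolic_partner_orthogonal {W : Submodule K V}
    (hW : ∀ x ∈ W, (∀ y ∈ W, QuadraticMap.polar Q x y = 0) → x = 0)
    {u v : V} (hu : u ∈ W) (hv : v ∈ W) (hv0 : v ≠ 0) (huv : ∀ c : K, u ≠ c • v)
    (hQu : Q u = 0) (ho : QuadraticMap.polar Q u v = 0) :
    ∃ f ∈ W, Q f = 0 ∧ QuadraticMap.polar Q u f = 1 ∧ QuadraticMap.polar Q v f = 0 := by
  obtain ⟨a, ha, hva⟩ : ∃ a ∈ W, QuadraticMap.polar Q v a ≠ 0 := by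
    by_contra! h
    exact hv0 (hW v hv h)
  obtain ⟨b, hb, hvb, hub⟩ : ∃ b ∈ W, QuadraticMap.polar Q v b = 0 ∧
      QuadraticMap.polar Q u b ≠ 0 := by
    by_contra! h
    refine huv (QuadraticMap.polar Q u a * (QuadraticMap.polar Q v a)⁻¹) (sub_eq_zero.1 ?_)
    refine hW _ (W.sub_mem hu (W.smul_mem _ hv)) fun y hy => ?_
    have h1 := h (y - (QuadraticMap.polar Q v y * (QuadraticMap.polar Q v a)⁻¹) • a)
      (W.sub_mem hy (W.smul_mem _ ha)) (by
        rw [QuadraticMap.polar_sub_right, QuadraticMap.polar_smul_right, smul_eq_mul,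
          inv_mul_cancel_right₀ hva, sub_self])
    rw [QuadraticMap.polar_sub_right, QuadraticMap.polar_smul_right, smul_eq_mul] at h1
    rw [QuadraticMap.polar_sub_left, QuadraticMap.polar_smul_left, smul_eq_mul]
    linear_combination h1
  obtain ⟨c, hf, hQf, huf⟩ := exists_hyperbolic_partner (a := (QuadraticMap.polar Q u b)⁻¹ • b) hu
    (W.smul_mem _ hb) hQu (by
      rw [QuadraticMap.polar_smul_right, smul_eq_mul, inv_mul_cancel₀ hub])
  refine ⟨_, hf, hQf, huf, ?_⟩
  rw [QuadraticMap.polar_sub_right, QuadraticMap.polar_smul_right, QuadraticMap.polar_smul_right,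
    hvb, QuadraticMap.polar_comm Q v u, ho]
  simp

end Hyperbolic

/-! ### Unipotent elements in normal subgroups -/

section Unipotent

variable {n : ℕ} {M : Matrix (Fin n) (Fin n) ℤ} {K : Type*} [Field K] [CharZero K] [Algebra ℚ K]
  {L : Submodule ℚ (Fin n → ℚ)}

theorem conj_mem_of_normal_subgroupOf {G : Type*} [Group G] {N H : Subgroup G} (hNH : N ≤ H)
    (hN : (N.subgroupOf H).Normal) {g h : G} (hg : g ∈ N) (hh : h ∈ H) : h * g * h⁻¹ ∈ N :=
  hN.conj_mem ⟨g, hNH hg⟩ hg ⟨h, hh⟩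

/-- The group `H_L` contains the elements `1 + u v` with `u` isotropic and `v` anisotropic and
orthogonal to `u`: they lie on the curve `t ↦ 1 + (t - 1) u v = (v⁻¹ + (t - 1) u) v` through `1`. -/
theorem exists_unipotent_mem_groupH {u v : Fin n → K} (hu : u ∈ extend K L) (hv : v ∈ extend K L)
    (hQu : form M K u = 0) (huv : QuadraticMap.polar (form M K) u v = 0) (hQv : form M K v ≠ 0) :
    ∃ g ∈ groupH M L K, (g : Cl M K) = 1 + ι (form M K) u * ι (form M K) v := by
  have hQ : ∀ t : K, form M K ((form M K v)⁻¹ • v + t • u) * form M K v = 1 := by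
    intro t
    rw [QuadraticMap.map_add (form M K), QuadraticMap.map_smul, QuadraticMap.map_smul, hQu,
      QuadraticMap.polar_smul_left, QuadraticMap.polar_smul_right, QuadraticMap.polar_comm, huv]
    simp only [smul_eq_mul, mul_zero, add_zero]
    field_simp
  have hval : ∀ t : K, (vecPair _ _ (hQ t) : Cl M K) =
      1 + t • (ι (form M K) u * ι (form M K) v) := by
    intro t
    rw [coe_vecPair, map_add, map_smul, map_smul, add_mul, smul_mul_assoc, smul_mul_assoc,
      ι_sq_scalar, Algebra.algebraMap_eq_smul_one, smul_smul, inv_mul_cancel₀ hQv, one_smul]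
  refine ⟨vecPair _ _ (hQ 1), ?_, by rw [hval, one_smul]⟩
  have h2 := mem_identityComponent_of_curve (G := stab M L K)
    (1 - ι (form M K) u * ι (form M K) v) (ι (form M K) u * ι (form M K) v) 0
    (fun t => vecPair _ _ (hQ ((t : K) - 1)))
    (fun t => by rw [hval, sub_smul, one_smul, smul_zero]; abel)
    (Subtype.ext (by rw [hval]; simp))
    (fun t => vecPair_mem_stab ((extend K L).add_mem ((extend K L).smul_mem _ hv)
      ((extend K L).smul_mem _ hu)) hv _) (Units.mk0 2 two_ne_zero)
  have e : (((Units.mk0 2 two_ne_zero : Kˣ) : K) - 1) = 1 := by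
    rw [Units.val_mk0]; norm_num
  simp only [e] at h2
  exact h2

/-- For a hyperbolic pair `u, f` in `L`, the group `H_L` contains an element scaling `u` by `4`
and `f` by `1/4`, and fixing the vectors orthogonal to both: the value at `t = 2` of the torus
`t ↦ t u f + t⁻¹ f u = (u + f) (t⁻¹ u + t f)`. -/
theorem exists_torus_mem_groupH {u f : Fin n → K} (hu : u ∈ extend K L) (hf : f ∈ extend K L)
    (hQu : form M K u = 0) (hQf : form M K f = 0) (huf : QuadraticMap.polar (form M K) u f = 1) :
    ∃ g ∈ groupH M L K, act g u = (4 : K) • u ∧ act g f = (4 : K)⁻¹ • f ∧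
      ∀ x, QuadraticMap.polar (form M K) u x = 0 → QuadraticMap.polar (form M K) f x = 0 →
        act g x = x := by
  have hfu : QuadraticMap.polar (form M K) f u = 1 := by rw [QuadraticMap.polar_comm, huf]
  have huu : QuadraticMap.polar (form M K) u u = 0 := by
    rw [QuadraticMap.polar_self, hQu, smul_zero]
  have hff : QuadraticMap.polar (form M K) f f = 0 := by
    rw [QuadraticMap.polar_self, hQf, smul_zero]
  have hQ2 : ∀ t : K, t ≠ 0 → form M K (t⁻¹ • u + t • f) = 1 := by
    intro t ht
    rw [QuadraticMap.map_add (form M K), QuadraticMap.map_smul, QuadraticMap.map_smul, hQu, hQf,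
      QuadraticMap.polar_smul_left, QuadraticMap.polar_smul_right, huf]
    simp [ht]
  have hQ1 : form M K (u + f) = 1 := by simpa using hQ2 1 one_ne_zero
  have hQ : ∀ t : Kˣ, form M K (u + f) * form M K ((t : K)⁻¹ • u + (t : K) • f) = 1 := fun t => by
    rw [hQ1, hQ2 _ t.ne_zero, one_mul]
  have h2 := mem_identityComponent_of_curve (G := stab M L K)
    0 (ι (form M K) u * ι (form M K) f) (ι (form M K) f * ι (form M K) u)
    (fun t => vecPair _ _ (hQ t))
    (fun t => by
      rw [coe_vecPair, map_add, map_add, map_smul, map_smul, add_mul, mul_add, mul_add,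
        mul_smul_comm, mul_smul_comm, mul_smul_comm, mul_smul_comm, ι_mul_self_eq_zero hQu,
        ι_mul_self_eq_zero hQf, smul_zero, smul_zero]
      abel)
    (Subtype.ext (by
      rw [coe_vecPair, Units.val_one, inv_one, one_smul, one_smul, ι_sq_scalar, hQ1, map_one]
      rfl))
    (fun t => vecPair_mem_stab ((extend K L).add_mem hu hf) ((extend K L).add_mem
      ((extend K L).smul_mem _ hu) ((extend K L).smul_mem _ hf)) _) (Units.mk0 2 two_ne_zero)
  refine ⟨_, h2, ?_, ?_, ?_⟩
  · rw [act_vecPair, sandwich, sandwich, hQ1, Units.val_mk0, hQ2 2 two_ne_zero]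
    simp only [QuadraticMap.polar_add_left, QuadraticMap.polar_smul_left,
      QuadraticMap.polar_smul_right, QuadraticMap.polar_sub_right, QuadraticMap.polar_add_right,
      huu, huf, hfu, hff, smul_eq_mul]
    module
  · rw [act_vecPair, sandwich, sandwich, hQ1, Units.val_mk0, hQ2 2 two_ne_zero]
    simp only [QuadraticMap.polar_add_left, QuadraticMap.polar_smul_left,
      QuadraticMap.polar_smul_right, QuadraticMap.polar_sub_right, QuadraticMap.polar_add_right,
      huu, huf, hfu, hff, smul_eq_mul]
    module
  · intro x hux hfx
    rw [act_vecPair, sandwich, sandwich, hQ1, Units.val_mk0, hQ2 2 two_ne_zero]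
    simp only [QuadraticMap.polar_add_left, QuadraticMap.polar_smul_left,
      QuadraticMap.polar_smul_right, QuadraticMap.polar_sub_right, QuadraticMap.polar_add_right,
      hux, hfx, smul_eq_mul]
    module

/-- If an element of a normal subgroup `N` of `H_L` moves an isotropic line `K u` of `L`, then `N`
contains an element `1 + u x` with `x` orthogonal to `u` and not in that line. -/
theorem exists_unipotent_mem_of_normal
    (hW : ∀ x ∈ extend K L, (∀ y ∈ extend K L, QuadraticMap.polar (form M K) x y = 0) → x = 0)
    {N : Subgroup (Spin M K)} (hNH : N ≤ groupH M L K) (hN : (N.subgroupOf (groupH M L K)).Normal)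
    {u v : Fin n → K} (hu : u ∈ extend K L) (hv : v ∈ extend K L) (hu0 : u ≠ 0)
    (hQu : form M K u = 0) (huv : QuadraticMap.polar (form M K) u v = 0) (hQv : form M K v ≠ 0)
    {g : Spin M K} (hg : g ∈ N) (hgu : ∀ c : K, act g u ≠ c • u) :
    ∃ x, QuadraticMap.polar (form M K) u x = 0 ∧ (∀ c : K, x ≠ c • u) ∧
      ∃ e ∈ N, (e : Cl M K) = 1 + ι (form M K) u * ι (form M K) x := by
  have hgs : g ∈ stab M L K := by
    let _ : TopologicalSpace (Spin M K) := spinZariski M K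
    exact connectedComponentIn_subset _ _ (hNH hg)
  set u' := act g u with hu'
  have hu'W : u' ∈ extend K L := (mem_stab_iff.1 hgs).1 u hu
  have hQu' : form M K u' = 0 := by rw [hu', map_act, hQu]
  -- an element of `H_L` that scales `u'` and `u` by different factors
  obtain ⟨h, hh, hhu', β, hβ, hhu⟩ : ∃ h ∈ groupH M L K, act h u' = (4 : K) • u' ∧
      ∃ β : K, (β = 1 ∨ β = 4⁻¹) ∧ act h u = β • u := by
    by_cases hp : QuadraticMap.polar (form M K) u' u = 0
    · obtain ⟨f, hf, hQf, huf, hvf⟩ :=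
        exists_hyperbolic_partner_orthogonal hW hu'W hu hu0 hgu hQu' hp
      obtain ⟨h, hh, h1, -, h2⟩ := exists_torus_mem_groupH hu'W hf hQu' hQf huf
      exact ⟨h, hh, h1, 1, Or.inl rfl, by
        rw [one_smul, h2 u hp (by rw [QuadraticMap.polar_comm, hvf])]⟩
    · obtain ⟨h, hh, h1, h2, -⟩ := exists_torus_mem_groupH (M := M) hu'W
        ((extend K L).smul_mem (QuadraticMap.polar (form M K) u' u)⁻¹ hu) hQu'
        (by rw [QuadraticMap.map_smul, hQu, smul_zero])
        (by rw [QuadraticMap.polar_smul_right, smul_eq_mul, inv_mul_cancel₀ hp])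
      refine ⟨h, hh, h1, 4⁻¹, Or.inr rfl, ?_⟩
      rw [map_smul, smul_comm] at h2
      exact smul_right_injective _ (inv_ne_zero hp) h2
  obtain ⟨E, hE, hEval⟩ := exists_unipotent_mem_groupH (M := M) hu hv hQu huv hQv
  have hEinv : ((E⁻¹ : Spin M K) : Cl M K) = 1 + ι (form M K) u * ι (form M K) (-v) := by
    have h1 := one_add_mul_one_add (-v) hQu huv
    rw [add_neg_cancel, map_zero, mul_zero, add_zero, ← hEval] at h1
    calc _ = ((E⁻¹ : Spin M K) : Cl M K) * (E * (1 + ι (form M K) u * ι (form M K) (-v))) := by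
          rw [h1, mul_one]
      _ = _ := by rw [← mul_assoc, coe_inv_mul_coe, one_mul]
  -- the commutator of `g⁻¹` and `h⁻¹` scales `u` by a factor `β / 4`, whose square is not `1`
  set m := g⁻¹ * (h⁻¹ * g * h) with hm
  have hmN : m ∈ N := by
    have h1 := conj_mem_of_normal_subgroupOf hNH hN hg (inv_mem hh)
    rw [inv_inv] at h1
    exact mul_mem (inv_mem hg) h1
  have hinv : act h⁻¹ u' = (4 : K)⁻¹ • u' := by
    have h1 := congrArg (act h⁻¹) hhu'
    rw [act_inv_act, map_smul] at h1
    exact (eq_inv_smul_iff₀ (by norm_num)).2 h1.symm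
  have hmu : act m u = (β * 4⁻¹) • u := by
    rw [hm, act_mul, act_mul, act_mul, hhu, map_smul, ← hu', map_smul, hinv, map_smul, map_smul,
      hu', act_inv_act, smul_smul]
  obtain ⟨hlam0, hlam⟩ : β * 4⁻¹ ≠ 0 ∧ (β * 4⁻¹) * (β * 4⁻¹) ≠ 1 := by
    rcases hβ with rfl | rfl <;> norm_num
  generalize β * 4⁻¹ = lam at hmu hlam0 hlam
  have humv : QuadraticMap.polar (form M K) u (act m v) = 0 := by
    have h1 := polar_act m u v
    rw [hmu, huv, QuadraticMap.polar_smul_left, smul_eq_mul] at h1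
    exact (mul_eq_zero.1 h1).resolve_left hlam0
  refine ⟨lam • act m v + -v, ?_, fun c hc => ?_, m * E * m⁻¹ * E⁻¹, ?_, ?_⟩
  · rw [QuadraticMap.polar_add_right, QuadraticMap.polar_smul_right, QuadraticMap.polar_neg_right,
      humv, huv]
    simp
  · -- comparing the values of the form at `lam • m v = v + c u`
    have h1 : lam • act m v = v + c • u := by rw [← hc]; abel
    have h2 := congrArg (form M K) h1
    rw [QuadraticMap.map_smul, map_act, QuadraticMap.map_add (form M K), QuadraticMap.map_smul, hQu,
      QuadraticMap.polar_smul_right, QuadraticMap.polar_comm, huv] at h2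
    simp only [smul_eq_mul, mul_zero, add_zero] at h2
    exact hlam (mul_right_cancel₀ hQv (h2.trans (one_mul _).symm))
  · have h1 := conj_mem_of_normal_subgroupOf hNH hN (inv_mem hmN) hE
    have e : m * E * m⁻¹ * E⁻¹ = m * (E * m⁻¹ * E⁻¹) := by group
    rw [e]
    exact mul_mem hmN h1
  · have h1 : ((m * E * m⁻¹ : Spin M K) : Cl M K) =
        1 + ι (form M K) u * ι (form M K) (lam • act m v) := by
      rw [Submonoid.coe_mul, Submonoid.coe_mul, hEval, mul_add, add_mul, mul_one, coe_mul_coe_inv,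
        map_smul, mul_smul_comm, ← smul_mul_assoc, ← map_smul, ← hmu, ι_act, ι_act]
      congr 1
      calc (m : Cl M K) * (ι (form M K) u * ι (form M K) v) * ((m⁻¹ : Spin M K) : Cl M K)
          = m * ι (form M K) u * 1 * ι (form M K) v * ((m⁻¹ : Spin M K) : Cl M K) := by
            noncomm_ring
        _ = _ := by rw [← coe_inv_mul_coe m]; noncomm_ring
    rw [Submonoid.coe_mul, h1, hEinv, one_add_mul_one_add _ hQu]
    rw [QuadraticMap.polar_smul_right, humv, smul_zero]

end Unipotent

/-! ### Rational points of a Galois stable subspace -/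

/-- A subspace of `Kⁿ` that is stable under the Galois group of `K/F` and contains, besides a
rational vector `u`, a vector outside the line of `u`, contains such a vector that is rational. -/
theorem exists_rational_mem_of_galois_stable {n : ℕ} {F K : Type*} [Field F] [Field K] [Algebra F K]
    [IsGalois F K] (A : Submodule K (Fin n → K))
    (hA : ∀ (σ : Gal(K/F)), ∀ x ∈ A, (fun i => σ (x i)) ∈ A) {u : Fin n → F} (hu0 : u ≠ 0)
    (hu : vecMap n F K u ∈ A) {x : Fin n → K} (hx : x ∈ A) (hxu : ∀ c : K, x ≠ c • vecMap n F K u) :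
    ∃ y : Fin n → F, vecMap n F K y ∈ A ∧ ∀ c : F, y ≠ c • u := by
  classical
  obtain ⟨k, hk⟩ := Function.ne_iff.1 hu0
  have hk' : algebraMap F K (u k) ≠ 0 := (map_ne_zero _).2 hk
  -- a nonzero vector of `A` of minimal support among those that vanish where `u` does not
  let P : ℕ → Prop := fun d => ∃ z ∈ A, z k = 0 ∧ z ≠ 0 ∧ (Finset.univ.filter (z · ≠ 0)).card = d
  have hP : ∃ d, P d := by
    refine ⟨_, x - (x k * (algebraMap F K (u k))⁻¹) • vecMap n F K u,
      A.sub_mem hx (A.smul_mem _ hu), ?_, fun h => hxu _ (sub_eq_zero.1 h), rfl⟩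
    change x k - x k * (algebraMap F K (u k))⁻¹ * algebraMap F K (u k) = 0
    rw [inv_mul_cancel_right₀ hk', sub_self]
  obtain ⟨z, hz, hzk, hz0, hzd⟩ := Nat.find_spec hP
  obtain ⟨i, hi⟩ := Function.ne_iff.1 hz0
  set w := (z i)⁻¹ • z with hw
  have hwi : w i = 1 := inv_mul_cancel₀ hi
  have hwA : w ∈ A := A.smul_mem _ hz
  have hfix : ∀ σ : Gal(K/F), ∀ l, σ (w l) = w l := by
    intro σ
    by_contra! h
    obtain ⟨l, hl⟩ := h
    have hlt : (Finset.univ.filter (((fun i => σ (w i)) - w) · ≠ 0)).card < Nat.find hP := by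
      rw [← hzd]
      refine Finset.card_lt_card (Finset.ssubset_iff_of_subset (fun l hl => ?_) |>.2 ⟨i, ?_, ?_⟩)
      · simp only [Finset.mem_filter, Finset.mem_univ, true_and] at hl ⊢
        intro h0
        apply hl
        have hwl : w l = 0 := by rw [hw, Pi.smul_apply, h0, smul_zero]
        rw [Pi.sub_apply, hwl, map_zero, sub_zero]
      · simpa using hi
      · simp [hwi]
    refine Nat.find_min hP hlt ⟨_, A.sub_mem (hA σ w hwA) hwA, ?_, ?_, rfl⟩
    · have hwk : w k = 0 := by rw [hw, Pi.smul_apply, hzk, smul_zero]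
      rw [Pi.sub_apply, hwk, map_zero, sub_zero]
    · intro h0
      exact hl (sub_eq_zero.1 (congrFun h0 l))
  have hrat : ∀ l, ∃ y : F, algebraMap F K y = w l := fun l =>
    IntermediateField.mem_bot.1 ((InfiniteGalois.mem_bot_iff_fixed (w l)).2 fun σ => hfix σ l)
  choose y hy using hrat
  have hyw : vecMap n F K y = w := funext hy
  refine ⟨y, hyw ▸ hwA, fun c hc => ?_⟩
  have hyk : y k = 0 := by
    apply (algebraMap F K).injective
    rw [hy, map_zero, hw, Pi.smul_apply, hzk, smul_zero]
  rw [hc, Pi.smul_apply, smul_eq_mul] at hyk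
  have hc0 : c = 0 := (mul_eq_zero.1 hyk).resolve_right hk
  have h1 := hy i
  rw [hwi, hc, hc0, zero_smul] at h1
  simp at h1

/-! ### Noncompactness from a unipotent element -/

section Noncompact

variable {n : ℕ} {M : Matrix (Fin n) (Fin n) ℤ} {F K : Type*} [Field F] [Field K] [Algebra F K]

theorem clMap_ι (x : Fin n → F) :
    clMap M F K (ι (form M F) x) = ι (form M K) (vecMap n F K x) := by
  rw [clMap, lift_ι_apply]; rfl

/-- Polynomial functions with coefficients in `F` commute with the Galois action on the points
`1 + u x` with `u` rational. -/
theorem apply_galois_of_mem_polyFun {f : Cl M K → K} (hf : f ∈ polyFun (K := K) F (clMap M F K))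
    (σ : Gal(K/F)) (u : Fin n → F) (x : Fin n → K) :
    f (1 + ι (form M K) (vecMap n F K u) * ι (form M K) (fun i => σ (x i))) =
      σ (f (1 + ι (form M K) (vecMap n F K u) * ι (form M K) x)) := by
  unfold polyFun at hf
  induction hf using Algebra.adjoin_induction with
  | mem f hf =>
    obtain ⟨φ, hφ, rfl⟩ := hf
    have hexp : ∀ y : Fin n → K,
        φ (1 + ι (form M K) (vecMap n F K u) * ι (form M K) y) = φ (clMap M F K 1) +
          ∑ i, y i * φ (clMap M F K (ι (form M F) u * ι (form M F) (Pi.single i 1))) := by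
      intro y
      have hy : y = ∑ i, y i • vecMap n F K (Pi.single i 1) := by
        funext k
        simp [vecMap, Finset.sum_apply, Pi.single_apply]
      conv_lhs => rw [hy]
      simp only [map_add, map_sum, map_smul, Finset.mul_sum, mul_smul_comm, map_mul, clMap_ι,
        map_one, smul_eq_mul]
    have hσ : ∀ a : Cl M F, σ (φ (clMap M F K a)) = φ (clMap M F K a) := by
      intro a
      obtain ⟨r, hr⟩ := hφ a
      rw [← hr, AlgEquiv.commutes]
    simp only [hexp, map_add, map_sum, map_mul σ, hσ]
  | algebraMap r => exact (AlgEquiv.commutes σ r).symm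
  | add f g _ _ hf hg => rw [Pi.add_apply, hf, hg, Pi.add_apply, map_add]
  | mul f g _ _ hf hg => rw [Pi.mul_apply, hf, hg, Pi.mul_apply, map_mul]

theorem polar_galois (σ : Gal(K/F)) (x y : Fin n → K) :
    QuadraticMap.polar (form M K) (fun i => σ (x i)) (fun i => σ (y i)) =
      σ (QuadraticMap.polar (form M K) x y) := by
  have h : ∀ z : Fin n → K, form M K (fun i => σ (z i)) = σ (form M K z) := fun z => by
    simp [form, Matrix.toQuadraticForm', Matrix.toLinearMap₂'_apply, map_sum]
  have e : (fun i => σ (x i)) + (fun i => σ (y i)) = fun i => σ ((x + y) i) :=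
    funext fun i => (map_add σ _ _).symm
  rw [QuadraticMap.polar, e, h, h, h, QuadraticMap.polar, map_sub, map_sub]

variable [CharZero K]

/-- If `1 + u x` lies in the algebraic group `N`, then so does the one-parameter group
`1 + t u x`. -/
theorem unipotent_smul_mem {N : Subgroup (Spin M K)} (hNF : IsAlgebraicOver F N) {u x : Fin n → K}
    (hQu : form M K u = 0) (hux : QuadraticMap.polar (form M K) u x = 0)
    (hx : ∃ e ∈ N, (e : Cl M K) = 1 + ι (form M K) u * ι (form M K) x) (t : K) :
    ∃ e ∈ N, (e : Cl M K) = 1 + ι (form M K) u * ι (form M K) (t • x) := by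
  obtain ⟨e, he, hex⟩ := hx
  have hpow : ∀ k : ℕ, ((e ^ k : Spin M K) : Cl M K) =
      1 + ι (form M K) u * ι (form M K) ((k : K) • x) := by
    intro k
    induction k with
    | zero => simp
    | succ k ih =>
      rw [pow_succ, Submonoid.coe_mul, ih, hex, one_add_mul_one_add _ hQu]
      · rw [Nat.cast_succ, add_smul, one_smul]
      · rw [QuadraticMap.polar_smul_right, hux, smul_zero]
  rcases eq_or_ne t 0 with rfl | ht
  · exact ⟨1, N.one_mem, by simp⟩
  refine mem_of_isClosed_zariski hNF fun f hf hfN => ?_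
  obtain ⟨P, d, hP⟩ := exists_polynomial_of_mem_polyFun hf 1
    (ι (form M K) u * ι (form M K) x) 0
  have hP0 : P = 0 := by
    refine Polynomial.eq_zero_of_infinite_isRoot P (Set.Infinite.mono ?_
      (Set.infinite_range_of_injective (f := fun k : ℕ => ((k + 1 : ℕ) : K))
        fun a b h => by simpa using h))
    rintro _ ⟨k, rfl⟩
    have h1 := hP ((k + 1 : ℕ) : K) (Nat.cast_ne_zero.2 k.succ_ne_zero)
    rw [smul_zero, add_zero, ← mul_smul_comm, ← map_smul, ← hpow,
      hfN _ ⟨_, pow_mem he _, rfl⟩, zero_mul] at h1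
    exact h1.symm
  have h1 := hP t ht
  rw [hP0, Polynomial.eval_zero, smul_zero, add_zero, ← mul_smul_comm, ← map_smul] at h1
  exact (mul_eq_zero.1 h1).resolve_right (pow_ne_zero _ ht)

/-- If the algebraic group `N` over `F` contains `1 + u x` with `u` rational and isotropic and `x`
orthogonal to `u` and not in its line, then it contains such an element with `x` rational. -/
theorem exists_rational_unipotent [IsGalois F K] {N : Subgroup (Spin M K)}
    (hNF : IsAlgebraicOver F N) {u : Fin n → F} (hu0 : u ≠ 0) (hQu : form M F u = 0)
    {x : Fin n → K} (hux : QuadraticMap.polar (form M K) (vecMap n F K u) x = 0)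
    (hxu : ∀ c : K, x ≠ c • vecMap n F K u)
    (hx : ∃ e ∈ N, (e : Cl M K) = 1 + ι (form M K) (vecMap n F K u) * ι (form M K) x) :
    ∃ y : Fin n → F, (∀ c : F, y ≠ c • u) ∧ ∀ t : F, ∃ e ∈ N,
      (e : Cl M K) = clMap M F K (1 + t • (ι (form M F) u * ι (form M F) y)) := by
  have hQu' : form M K (vecMap n F K u) = 0 := by rw [form_vecMap, hQu, map_zero]
  have huu : QuadraticMap.polar (form M K) (vecMap n F K u) (vecMap n F K u) = 0 := by
    rw [QuadraticMap.polar_self, hQu', smul_zero]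
  let A : Submodule K (Fin n → K) :=
    { carrier := {z | QuadraticMap.polar (form M K) (vecMap n F K u) z = 0 ∧
        ∃ e ∈ N, (e : Cl M K) = 1 + ι (form M K) (vecMap n F K u) * ι (form M K) z}
      zero_mem' := ⟨by simp, 1, N.one_mem, by simp⟩
      add_mem' := by
        rintro z w ⟨hz, e, he, hez⟩ ⟨hw, e', he', hew⟩
        refine ⟨by rw [QuadraticMap.polar_add_right, hz, hw, add_zero], e * e', mul_mem he he', ?_⟩
        rw [Submonoid.coe_mul, hez, hew, one_add_mul_one_add _ hQu' hz]
      smul_mem' := by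
        rintro c z ⟨hz, hze⟩
        exact ⟨by rw [QuadraticMap.polar_smul_right, hz, smul_zero],
          unipotent_smul_mem hNF hQu' hz hze c⟩ }
  have hAσ : ∀ (σ : Gal(K/F)), ∀ z ∈ A, (fun i => σ (z i)) ∈ A := by
    rintro σ z ⟨hz, hze⟩
    refine ⟨?_, ?_⟩
    · have hu' : vecMap n F K u = fun i => σ (vecMap n F K u i) :=
        funext fun i => (σ.commutes (u i)).symm
      rw [hu', polar_galois, hz, map_zero]
    · refine mem_of_isClosed_zariski hNF fun f hf hfN => ?_
      obtain ⟨e, he, hez⟩ := hze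
      rw [apply_galois_of_mem_polyFun hf, ← hez, hfN _ ⟨e, he, rfl⟩, map_zero]
  obtain ⟨y, ⟨hy, hye⟩, hyu⟩ := exists_rational_mem_of_galois_stable A hAσ hu0
    (⟨huu, 1, N.one_mem, by rw [ι_mul_self_eq_zero hQu', add_zero]; rfl⟩) ⟨hux, hx⟩ hxu
  refine ⟨y, hyu, fun t => ?_⟩
  obtain ⟨e, he, hee⟩ := unipotent_smul_mem hNF hQu' hy hye (algebraMap F K t)
  refine ⟨e, he, ?_⟩
  rw [hee, map_add, map_one, map_smul (clMap M F K), map_mul, clMap_ι, clMap_ι, map_smul,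
    mul_smul_comm, algebraMap_smul]

/-- A subset of a vector space over a nontrivially normed field that contains an affine line is not
compact in the module topology. -/
theorem not_isCompact_of_line {F V : Type*} [NontriviallyNormedField F] [AddCommGroup V]
    [Module F V] {S : Set V} {a b : V} (hb : b ≠ 0) (hS : ∀ t : F, a + t • b ∈ S) :
    ¬ @IsCompact V (moduleTopology F V) S := by
  intro hc
  let _ : TopologicalSpace V := moduleTopology F V
  have : IsModuleTopology F V := ⟨rfl⟩
  obtain ⟨φ, hφ⟩ : ∃ φ : Module.Dual F V, φ b ≠ 0 := by
    by_contra! h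
    exact hb ((Module.forall_dual_apply_eq_zero_iff F b).1 h)
  have h1 : IsCompact (φ '' S) := hc.image (IsModuleTopology.continuous_of_linearMap φ)
  have h2 : φ '' S = Set.univ := by
    refine Set.eq_univ_of_forall fun c => ⟨_, hS ((c - φ a) * (φ b)⁻¹), ?_⟩
    rw [map_add, map_smul, smul_eq_mul, inv_mul_cancel_right₀ hφ, add_sub_cancel]
  rw [h2] at h1
  obtain ⟨C, hC⟩ := h1.isBounded.exists_norm_le
  obtain ⟨x, hx⟩ := NormedField.exists_lt_norm F C
  exact absurd (hC x (Set.mem_univ x)) (not_le.2 hx)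

end Noncompact

/-! ### Normal subgroups with compact groups of rational points -/

section Core

variable {n : ℕ} {M : Matrix (Fin n) (Fin n) ℤ} {F K : Type*} [Field K] [CharZero K]

/-- An isometry that preserves every rational isotropic line of an isotropic rational subspace acts
on that subspace as a scalar. -/
theorem exists_scalar_of_isotropic_lines [Algebra ℚ K] [Field F] [Algebra F K] [Algebra ℚ F]
    {L : Submodule ℚ (Fin n → ℚ)}
    (hW : ∀ x ∈ extend F L, (∀ y ∈ extend F L, QuadraticMap.polar (form M F) x y = 0) → x = 0)
    (hd : 3 ≤ Module.finrank F (extend F L)) {u : Fin n → F} (hu : u ∈ extend F L) (hu0 : u ≠ 0)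
    (hQu : form M F u = 0) (g : Spin M K)
    (hg : ∀ v ∈ extend F L, v ≠ 0 → form M F v = 0 →
      ∃ c : K, act g (vecMap n F K v) = c • vecMap n F K v) :
    ∃ c : K, ∀ x ∈ extend K L, act g x = c • x := by
  obtain ⟨f, hf, w, hw, hQf, huf, huw, hfw, hQw⟩ := exists_hyperbolic_triple hW hd hu hu0 hQu
  have hfu : QuadraticMap.polar (form M F) f u = 1 := by rw [QuadraticMap.polar_comm, huf]
  have huu : QuadraticMap.polar (form M F) u u = 0 := by
    rw [QuadraticMap.polar_self, hQu, smul_zero]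
  have hff : QuadraticMap.polar (form M F) f f = 0 := by
    rw [QuadraticMap.polar_self, hQf, smul_zero]
  obtain ⟨α, hα⟩ := hg u hu hu0 hQu
  -- `f + z - Q(z) u` is isotropic, and `g` scales all these vectors by `α⁻¹`
  have key : ∀ z ∈ extend F L, QuadraticMap.polar (form M F) u z = 0 →
      QuadraticMap.polar (form M F) f z = 0 → ∃ c : K, α * c = 1 ∧
        act g (vecMap n F K (f + z + (-form M F z) • u)) =
          c • vecMap n F K (f + z + (-form M F z) • u) := by
    intro z hz huz hfz
    have hp : QuadraticMap.polar (form M F) u (f + z + (-form M F z) • u) = 1 := by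
      rw [QuadraticMap.polar_add_right, QuadraticMap.polar_add_right,
        QuadraticMap.polar_smul_right, huf, huz, huu]
      simp
    obtain ⟨c, hc⟩ := hg (f + z + (-form M F z) • u)
      (Submodule.add_mem _ (Submodule.add_mem _ hf hz) (Submodule.smul_mem _ _ hu))
      (fun h0 => by rw [h0, QuadraticMap.polar_zero_right] at hp; exact zero_ne_one hp)
      (by
        rw [QuadraticMap.map_add (form M F), QuadraticMap.map_add (form M F),
          QuadraticMap.map_smul, QuadraticMap.polar_smul_right, QuadraticMap.polar_add_left, hQf,
          hQu, hfz, hfu, QuadraticMap.polar_comm, huz]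
        simp)
    refine ⟨c, ?_, hc⟩
    have h1 := polar_act g (vecMap n F K u) (vecMap n F K (f + z + (-form M F z) • u))
    rw [hα, hc, QuadraticMap.polar_smul_left, QuadraticMap.polar_smul_right, polar_vecMap, hp,
      map_one] at h1
    simpa using h1
  have key2 : ∀ z ∈ extend F L, QuadraticMap.polar (form M F) u z = 0 →
      QuadraticMap.polar (form M F) f z = 0 →
        act g (vecMap n F K f) + act g (vecMap n F K z) -
          (algebraMap F K (form M F z) * α) • vecMap n F K u =
        α⁻¹ • (vecMap n F K f + vecMap n F K z -
          algebraMap F K (form M F z) • vecMap n F K u) := by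
    intro z hz huz hfz
    obtain ⟨c, hc, h1⟩ := key z hz huz hfz
    rw [eq_inv_of_mul_eq_one_right hc] at h1
    simp only [map_add, vecMap_smul, map_neg, neg_smul] at h1
    rw [map_smul (act g), hα] at h1
    rw [← sub_eq_add_neg, ← sub_eq_add_neg, smul_smul] at h1
    exact h1
  have hu0' : vecMap n F K u ≠ 0 := fun h =>
    hu0 (vecMap_injective n F K (h.trans (map_zero _).symm))
  have hα2 : α⁻¹ = α := by
    have h1 := key2 w hw huw hfw
    have h2 := key2 (-w) (Submodule.neg_mem _ hw)
      (by rw [QuadraticMap.polar_neg_right, huw, neg_zero])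
      (by rw [QuadraticMap.polar_neg_right, hfw, neg_zero])
    have h0 := key2 0 (Submodule.zero_mem _) (by simp) (by simp)
    simp only [map_zero, zero_mul, zero_smul, add_zero, sub_zero] at h0
    rw [QuadraticMap.map_neg, map_neg, map_neg] at h2
    have h3 : (2 * algebraMap F K (form M F w) * (α⁻¹ - α)) • vecMap n F K u = 0 := by
      linear_combination (norm := module) h1 + h2 - (2 : K) • h0
    rcases smul_eq_zero.1 h3 with h4 | h4
    · have h5 : algebraMap F K (form M F w) ≠ 0 := (map_ne_zero _).2 hQw
      exact sub_eq_zero.1 ((mul_eq_zero.1 h4).resolve_left (mul_ne_zero two_ne_zero h5))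
    · exact absurd h4 hu0'
  refine ⟨α, fun x hx => ?_⟩
  have h0 := key2 0 (Submodule.zero_mem _) (by simp) (by simp)
  simp only [map_zero, zero_mul, zero_smul, add_zero, sub_zero, hα2] at h0
  have hx2 := extend_le_span_vecMap F L hx
  clear hx
  induction hx2 using Submodule.span_induction with
  | mem x hx =>
    obtain ⟨y, hy, rfl⟩ := hx
    set z := y - QuadraticMap.polar (form M F) f y • u - QuadraticMap.polar (form M F) u y • f
      with hz
    have h1 := key2 z (Submodule.sub_mem _ (Submodule.sub_mem _ hy (Submodule.smul_mem _ _ hu))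
      (Submodule.smul_mem _ _ hf))
      (by simp [hz, QuadraticMap.polar_sub_right, QuadraticMap.polar_smul_right, huu, huf])
      (by simp [hz, QuadraticMap.polar_sub_right, QuadraticMap.polar_smul_right, hff, hfu])
    rw [hα2] at h1
    have h2 : act g (vecMap n F K z) = α • vecMap n F K z := by
      linear_combination (norm := module) h1 - h0
    have h3 : y = z + QuadraticMap.polar (form M F) f y • u +
        QuadraticMap.polar (form M F) u y • f := by rw [hz]; abel
    rw [h3]
    simp only [map_add, vecMap_smul, map_smul (act g), h2, h0, hα]
    module
  | zero => simp
  | add x y _ _ hx hy => rw [map_add, hx, hy, smul_add]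
  | smul c x _ hx => rw [map_smul, hx, smul_comm]

/-- A Zariski connected group acting by scalars on a subspace acts trivially on it. -/
theorem act_eq_self_of_isConnected {N : Subgroup (Spin M K)}
    (hN : @IsConnected _ (spinZariski M K) (N : Set (Spin M K))) {W : Submodule K (Fin n → K)}
    {w : Fin n → K} (hw : w ∈ W) (hQw : form M K w ≠ 0)
    (hs : ∀ g ∈ N, ∃ c : K, ∀ x ∈ W, act g x = c • x) : ∀ g ∈ N, ∀ x ∈ W, act g x = x := by
  have hw0 : w ≠ 0 := by rintro rfl; exact hQw (QuadraticMap.map_zero _)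
  have hS : ∀ g ∈ N, (g : Cl M K) * ι (form M K) w - ι (form M K) w * g = 0 := by
    refine linearMap_eq_of_isConnected hN
      (LinearMap.mulRight K (ι (form M K) w) - LinearMap.mulLeft K (ι (form M K) w))
      (LinearMap.mulRight K (ι (form M K) w) + LinearMap.mulLeft K (ι (form M K) w)) 0 0 ?_ ?_ ?_
    · intro g hg
      obtain ⟨c, hc⟩ := hs g hg
      have h1 := map_act g w
      rw [hc w hw, QuadraticMap.map_smul, smul_eq_mul] at h1
      have h2 : c * c = 1 := mul_right_cancel₀ hQw (h1.trans (one_mul _).symm)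
      have h3 := (act_eq_iff g w _).1 (hc w hw)
      simp only [LinearMap.sub_apply, LinearMap.add_apply, LinearMap.mulRight_apply,
        LinearMap.mulLeft_apply, h3]
      rcases mul_self_eq_one_iff.1 h2 with rfl | rfl
      · left; simp
      · right; simp
    · intro g _ h1 h2
      simp only [LinearMap.sub_apply, LinearMap.add_apply, LinearMap.mulRight_apply,
        LinearMap.mulLeft_apply] at h1 h2
      have h3 : (2 : K) • ((g : Cl M K) * ι (form M K) w) = 0 := by
        calc _ = ((g : Cl M K) * ι (form M K) w - ι (form M K) w * g) +
              ((g : Cl M K) * ι (form M K) w + ι (form M K) w * g) := by rw [two_smul]; abel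
          _ = 0 := by rw [h1, h2, add_zero]
      have h4 := (smul_eq_zero.1 h3).resolve_left two_ne_zero
      have h5 : ι (form M K) w = 0 := by
        rw [← one_mul (ι (form M K) w), ← coe_inv_mul_coe g, mul_assoc, h4, mul_zero]
      exact hw0 (ι_injective (h5.trans (map_zero _).symm))
    · simp
  intro g hg x hx
  obtain ⟨c, hc⟩ := hs g hg
  have h1 : act g w = w := (act_eq_iff g w w).2 (sub_eq_zero.1 (hS g hg))
  have h2 : (c - 1) • w = 0 := by rw [sub_smul, one_smul, ← hc w hw, h1, sub_self]
  have h3 : c = 1 := sub_eq_zero.1 ((smul_eq_zero.1 h2).resolve_right hw0)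
  rw [hc x hx, h3, one_smul]

/-- A Zariski connected subgroup of the spin group that acts trivially on all vectors is trivial,
as the kernel of `Spin → SO` is finite. -/
theorem eq_bot_of_act_eq_self (hQ : ∀ v, (∀ w, QuadraticMap.polar (form M K) v w = 0) → v = 0)
    {N : Subgroup (Spin M K)}
    (hN : @IsConnected _ (spinZariski M K) (N : Set (Spin M K)))
    (h : ∀ g ∈ N, ∀ x, act g x = x) : N = ⊥ := by
  have hnt : Nontrivial (Cl M K) := clifford_nontrivial
  have hr : ∀ g ∈ N, (g : Cl M K) = 1 ∨ (g : Cl M K) = -1 := by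
    intro g hg
    obtain ⟨r, hr⟩ := exists_algebraMap_of_even_of_commute hQ (g : Cl M K)
      (spinGroup.involute_eq g.2) (fun v => ((act_eq_iff g v v).1 (h g hg v)).symm)
    have h1 : (g : Cl M K) * star (g : Cl M K) = 1 := spinGroup.mul_star_self_of_mem g.2
    rw [hr, star_algebraMap, ← map_mul, ← map_one (algebraMap K _)] at h1
    rcases mul_self_eq_one_iff.1 (algebraMap_clifford_injective h1) with rfl | rfl
    · left; rw [hr, map_one]
    · right; rw [hr, map_neg, map_one]
  have hne : (1 : Cl M K) ≠ -1 := by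
    intro h1
    have h2 := algebraMap_clifford_injective (Q := form M K) (a₁ := 1) (a₂ := -1)
      (by rw [map_neg, map_one]; exact h1)
    exact one_ne_zero (self_eq_neg.1 h2)
  have h1 := linearMap_eq_of_isConnected hN LinearMap.id LinearMap.id 1 (-1) hr
    (fun g _ hg hg' => hne (hg.symm.trans hg')) rfl
  exact (Subgroup.eq_bot_iff_forall N).2 fun g hg => Subtype.ext (h1 g hg)

/-- A connected normal subgroup of `H_L` over `F` with compact group of `F`-points acts trivially
on `L` if `L` is isotropic over `F`. -/
theorem act_eq_self_of_isCompact_points [Algebra ℚ K] [NontriviallyNormedField F]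
    [Algebra F K] [Algebra ℚ F] [IsGalois F K] {L L' : Submodule ℚ (Fin n → ℚ)}
    (hQF : ∀ v, (∀ w, QuadraticMap.polar (form M F) v w = 0) → v = 0)
    (hQK : ∀ v, (∀ w, QuadraticMap.polar (form M K) v w = 0) → v = 0)
    (ho : ∀ x ∈ L, ∀ y ∈ L', QuadraticMap.polar (form M ℚ) x y = 0) (ht : L ⊔ L' = ⊤)
    (hd : 3 ≤ Module.finrank ℚ L) (hiso : ∃ u ∈ extend F L, u ≠ 0 ∧ form M F u = 0)
    {N : Subgroup (Spin M K)} (hNH : N ≤ groupH M L K)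
    (hNn : (N.subgroupOf (groupH M L K)).Normal) (hNF : IsAlgebraicOver F N)
    (hNc : @IsConnected _ (spinZariski M K) (N : Set (Spin M K)))
    (hc : @IsCompact (Cl M F) (moduleTopology F (Cl M F)) (points F N)) :
    ∀ g ∈ N, ∀ x ∈ extend K L, act g x = x := by
  have hWF : ∀ x ∈ extend F L, (∀ y ∈ extend F L, QuadraticMap.polar (form M F) x y = 0) → x = 0 :=
    fun x hx h => eq_zero_of_forall_polar_eq_zero hQF (extend_orthogonal F ho)
      (extend_sup_eq_top F ht) hx h
  have hWK : ∀ x ∈ extend K L, (∀ y ∈ extend K L, QuadraticMap.polar (form M K) x y = 0) → x = 0 :=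
    fun x hx h => eq_zero_of_forall_polar_eq_zero hQK (extend_orthogonal K ho)
      (extend_sup_eq_top K ht) hx h
  have hdF : 3 ≤ Module.finrank F (extend F L) := hd.trans (finrank_le_finrank_extend F L)
  have : CharZero F := algebraRat.charZero F
  obtain ⟨u, hu, hu0, hQu⟩ := hiso
  obtain ⟨f, -, w, hw, -, -, -, -, hQw⟩ := exists_hyperbolic_triple hWF hdF hu hu0 hQu
  refine act_eq_self_of_isConnected hNc (vecMap_mem_extend_extend hw)
    (by rw [form_vecMap]; exact (map_ne_zero _).2 hQw) fun g hg => ?_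
  refine exists_scalar_of_isotropic_lines hWF hdF hu hu0 hQu g fun v hv hv0 hQv => ?_
  by_contra! hgv
  obtain ⟨-, -, z, hz, -, -, hvz, -, hQz⟩ := exists_hyperbolic_triple hWF hdF hv hv0 hQv
  have hv0' : vecMap n F K v ≠ 0 := fun h =>
    hv0 (vecMap_injective n F K (h.trans (map_zero _).symm))
  obtain ⟨x, hvx, hxv, hx⟩ := exists_unipotent_mem_of_normal hWK hNH hNn
    (vecMap_mem_extend_extend hv) (vecMap_mem_extend_extend hz) hv0'
    (by rw [form_vecMap, hQv, map_zero]) (by rw [polar_vecMap, hvz, map_zero])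
    (by rw [form_vecMap]; exact (map_ne_zero _).2 hQz) hg hgv
  obtain ⟨y, hyv, hy⟩ := exists_rational_unipotent hNF hv0 hQv hvx hxv hx
  exact not_isCompact_of_line (ι_mul_ι_ne_zero hQF hv0 hyv) hy hc

/-- The strong isotropy of `H_L` follows from the isotropy of `L` and of its orthogonal
complement. -/
theorem stronglyIsotropicAt_of_isotropic {p : ℕ} [Fact p.Prime] {L L' : Submodule ℚ (Fin n → ℚ)}
    (hsymm : M.IsSymm) (hM : M.det ≠ 0)
    (ho : ∀ x ∈ L, ∀ y ∈ L', QuadraticMap.polar (form M ℚ) x y = 0) (ht : L ⊔ L' = ⊤)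
    (hd : 3 ≤ Module.finrank ℚ L) (hd' : 3 ≤ Module.finrank ℚ L')
    (hiso : ∃ u ∈ extend ℚ_[p] L, u ≠ 0 ∧ form M ℚ_[p] u = 0)
    (hiso' : ∃ u ∈ extend ℚ_[p] L', u ≠ 0 ∧ form M ℚ_[p] u = 0) :
    StronglyIsotropicAt p (groupH M L (AlgebraicClosure ℚ_[p])) := by
  have hQ : ∀ (E : Type) [Field E] [CharZero E],
      ∀ v, (∀ w, QuadraticMap.polar (form M E) v w = 0) → v = 0 := fun E _ _ v hv =>
    eq_zero_of_forall_polar_form_eq_zero hsymm hM E hv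
  have ho' : ∀ x ∈ L', ∀ y ∈ L, QuadraticMap.polar (form M ℚ) x y = 0 :=
    fun x hx y hy => (QuadraticMap.polar_comm _ _ _).trans (ho y hy x hx)
  have ht' : L' ⊔ L = ⊤ := by rw [sup_comm, ht]
  intro N hNH hNn hNF hNc hN hc
  have hG : groupH M L (AlgebraicClosure ℚ_[p]) = groupH M L' (AlgebraicClosure ℚ_[p]) := by
    unfold groupH
    rw [stab_eq_stab_of_orthogonal (hQ _) ho ht]
  have h1 := act_eq_self_of_isCompact_points (hQ _) (hQ _) ho ht hd hiso hNH hNn hNF hNc hc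
  have h2 := act_eq_self_of_isCompact_points (hQ _) (hQ _) ho' ht' hd' hiso' (hG ▸ hNH) (hG ▸ hNn)
    hNF hNc hc
  refine hN (eq_bot_of_act_eq_self (hQ _) hNc fun g hg x => ?_)
  obtain ⟨a, ha, b, hb, rfl⟩ := Submodule.mem_sup.1
    (extend_sup_eq_top (AlgebraicClosure ℚ_[p]) ht ▸ Submodule.mem_top : x ∈ _)
  rw [map_add, h1 g hg a ha, h2 g hg b hb]

end Core

/-! ### Isotropic quadratic forms over `ℚ_p` -/

section Padic

variable {p : ℕ} [Fact p.Prime]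

theorem isUnit_iff_toZMod_ne_zero (x : ℤ_[p]) : IsUnit x ↔ PadicInt.toZMod x ≠ 0 := by
  rw [ne_eq, ← RingHom.mem_ker, PadicInt.ker_toZMod, IsLocalRing.mem_maximalIdeal, mem_nonunits_iff,
    not_not]

/-- A quadratic form in at least three variables over the field with `p` elements has a nontrivial
zero, by the Chevalley-Warning theorem. -/
theorem exists_isotropic_zmod {m : ℕ} (hm : 3 ≤ m) (G : Matrix (Fin m) (Fin m) (ZMod p)) :
    ∃ x : Fin m → ZMod p, x ≠ 0 ∧ x ⬝ᵥ (G *ᵥ x) = 0 := by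
  classical
  let f : MvPolynomial (Fin m) (ZMod p) := ∑ i, .X i * ∑ j, .C (G i j) * .X j
  have hf : ∀ x : Fin m → ZMod p, MvPolynomial.eval x f = x ⬝ᵥ (G *ᵥ x) := by
    intro x
    simp [f, dotProduct, mulVec]
  have hdeg : f.totalDegree < Fintype.card (Fin m) := by
    rw [Fintype.card_fin]
    refine lt_of_le_of_lt (MvPolynomial.totalDegree_finsetSum_le (d := 2) fun i _ => ?_) hm
    refine (MvPolynomial.totalDegree_mul _ _).trans ?_
    refine Nat.add_le_add (MvPolynomial.totalDegree_X _).le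
      (MvPolynomial.totalDegree_finsetSum_le (d := 1) fun j _ => ?_)
    refine (MvPolynomial.totalDegree_mul _ _).trans ?_
    rw [MvPolynomial.totalDegree_C, MvPolynomial.totalDegree_X, zero_add]
  have hdvd := char_dvd_card_solutions p hdeg
  have hlt : 1 < Fintype.card {x // MvPolynomial.eval x f = 0} := by
    have : Nonempty {x // MvPolynomial.eval x f = 0} := ⟨⟨0, by rw [hf]; simp⟩⟩
    exact (Fact.out : p.Prime).one_lt.trans_le (Nat.le_of_dvd Fintype.card_pos hdvd)
  obtain ⟨⟨x, hx⟩, hne⟩ := Fintype.exists_ne_of_one_lt_card hlt ⟨0, by rw [hf]; simp⟩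
  exact ⟨x, fun h => hne (Subtype.ext h), by rw [← hf, hx]⟩

/-- A unimodular quadratic form in at least three variables over `ℤ_p`, `p` odd, has a nontrivial
zero: a zero modulo `p` lifts along a line by Hensel's lemma. -/
theorem exists_isotropic_of_unimodular (hp : p ≠ 2) {m : ℕ} (hm : 3 ≤ m)
    {G : Matrix (Fin m) (Fin m) ℤ_[p]} (hG : G.IsSymm)
    (hu : ∀ x : Fin m → ℤ_[p], (∃ i, IsUnit (x i)) → ∃ y, IsUnit (x ⬝ᵥ (G *ᵥ y))) :
    ∃ x : Fin m → ℤ_[p], x ≠ 0 ∧ x ⬝ᵥ (G *ᵥ x) = 0 := by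
  obtain ⟨x', hx0, hx⟩ := exists_isotropic_zmod hm (G.map PadicInt.toZMod)
  choose x hxx using fun i => ZMod.ringHom_surjective (PadicInt.toZMod (p := p)) (x' i)
  obtain ⟨i, hi⟩ := Function.ne_iff.1 hx0
  have hxi : IsUnit (x i) := (isUnit_iff_toZMod_ne_zero _).2 (by rw [hxx]; exact hi)
  obtain ⟨y, hy⟩ := hu x ⟨i, hxi⟩
  have hnx : ‖x ⬝ᵥ (G *ᵥ x)‖ < 1 := by
    rw [← PadicInt.mem_nonunits, mem_nonunits_iff, isUnit_iff_toZMod_ne_zero, not_not]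
    have e : x' = PadicInt.toZMod ∘ x := funext fun i => (hxx i).symm
    rw [RingHom.map_dotProduct, ← e, ← hx]
    congr 1
    funext i
    rw [Function.comp_apply, RingHom.map_mulVec, ← e]
  -- `2` is a unit, as `p` is odd
  have h2 : ‖(2 : ℤ_[p])‖ = 1 := by
    refine PadicInt.isUnit_iff.1 ((isUnit_iff_toZMod_ne_zero _).2 fun h => hp ?_)
    rw [map_ofNat] at h
    exact (Nat.prime_dvd_prime_iff_eq Fact.out Nat.prime_two).1
      ((ZMod.natCast_eq_zero_iff 2 p).1 (by exact_mod_cast h))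
  let P : Polynomial ℤ_[p] := .C (x ⬝ᵥ (G *ᵥ x)) + .C (2 * (x ⬝ᵥ (G *ᵥ y))) * .X +
    .C (y ⬝ᵥ (G *ᵥ y)) * .X ^ 2
  have hP : ∀ t, P.eval t = (x + t • y) ⬝ᵥ (G *ᵥ (x + t • y)) := by
    intro t
    have hs : y ⬝ᵥ (G *ᵥ x) = x ⬝ᵥ (G *ᵥ y) := by
      rw [Matrix.dotProduct_mulVec, ← Matrix.mulVec_transpose, hG, dotProduct_comm]
    simp only [P, Polynomial.eval_add, Polynomial.eval_mul, Polynomial.eval_C, Polynomial.eval_X,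
      Polynomial.eval_pow, Matrix.mulVec_add, Matrix.mulVec_smul, add_dotProduct, dotProduct_add,
      smul_dotProduct, dotProduct_smul, hs, smul_eq_mul]
    ring
  have hd : ‖P.derivative.eval 0‖ = 1 := by
    have : P.derivative.eval 0 = 2 * (x ⬝ᵥ (G *ᵥ y)) := by simp [P]
    rw [this, norm_mul, h2, PadicInt.isUnit_iff.1 hy, one_mul]
  obtain ⟨z, hz, hz1, -⟩ := hensels_lemma (F := P) (a := (0 : ℤ_[p])) (by
    rw [Polynomial.coe_aeval_eq_eval, hd, hP]
    simpa using hnx)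
  rw [Polynomial.coe_aeval_eq_eval] at hz
  rw [Polynomial.coe_aeval_eq_eval, hd, sub_zero] at hz1
  refine ⟨x + z • y, fun h0 => ?_, by rw [← hP, hz]⟩
  have h3 : x i = -(z * y i) := eq_neg_of_add_eq_zero_left (congrFun h0 i)
  have h4 : ‖x i‖ < 1 := by
    rw [h3, norm_neg, norm_mul]
    exact (mul_le_of_le_one_right (norm_nonneg _) (PadicInt.norm_le_one _)).trans_lt hz1
  exact h4.ne (PadicInt.isUnit_iff.1 hxi)

/-- Nonzero elements of `ℚ_p` are units times `1` or `p` up to squares. -/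
theorem exists_unit_mul_sq {c : ℚ_[p]} (hc : c ≠ 0) :
    ∃ (e : Fin 2) (a : ℚ_[p]) (u : ℤ_[p]ˣ), a ≠ 0 ∧
      c = (u : ℤ_[p]) * (p : ℚ_[p]) ^ (e : ℕ) * a ^ 2 := by
  have hp0 : (p : ℚ_[p]) ≠ 0 := Nat.cast_ne_zero.2 (Fact.out : p.Prime).ne_zero
  obtain ⟨u, hu⟩ : ∃ u : ℤ_[p]ˣ, c = (u : ℤ_[p]) * (p : ℚ_[p]) ^ c.valuation := by
    have h1 : ‖c * (p : ℚ_[p]) ^ (-c.valuation)‖ = 1 := by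
      rw [norm_mul, Padic.norm_eq_zpow_neg_valuation hc, norm_zpow, Padic.norm_p,
        _root_.inv_zpow, _root_.zpow_neg, inv_inv, inv_mul_cancel₀]
      exact zpow_ne_zero _ (Nat.cast_ne_zero.2 (Fact.out : p.Prime).ne_zero)
    refine ⟨PadicInt.mkUnits h1, ?_⟩
    rw [PadicInt.mkUnits_eq, mul_assoc, ← zpow_add₀ hp0, neg_add_cancel, zpow_zero, mul_one]
  rcases Int.even_or_odd' c.valuation with ⟨k, hk | hk⟩
  · refine ⟨0, (p : ℚ_[p]) ^ k, u, zpow_ne_zero _ hp0, ?_⟩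
    rw [Fin.val_zero, pow_zero, mul_one, ← zpow_natCast, ← _root_.zpow_mul, mul_comm k]
    rw [hk] at hu
    exact hu
  · refine ⟨1, (p : ℚ_[p]) ^ k, u, zpow_ne_zero _ hp0, ?_⟩
    rw [Fin.val_one, pow_one, mul_assoc, ← zpow_natCast, ← _root_.zpow_mul, mul_comm k,
      ← zpow_one_add₀ hp0, add_comm]
    rw [hk] at hu
    exact hu

/-- A diagonal ternary form with unit coefficients is isotropic. -/
theorem exists_isotropic_three (hp : p ≠ 2) (u : Fin 3 → ℤ_[p]ˣ) :
    ∃ x : Fin 3 → ℤ_[p], x ≠ 0 ∧ ∑ i, (u i : ℤ_[p]) * x i ^ 2 = 0 := by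
  obtain ⟨x, hx0, hx⟩ := exists_isotropic_of_unimodular hp le_rfl
    (G := Matrix.diagonal fun i => (u i : ℤ_[p])) (Matrix.isSymm_diagonal _) (by
      rintro x ⟨i, hi⟩
      refine ⟨Pi.single i 1, ?_⟩
      rw [Matrix.diagonal_mulVec_single, mul_one, dotProduct_single]
      exact hi.mul (u i).isUnit)
  refine ⟨x, hx0, ?_⟩
  rw [← hx]
  simp only [dotProduct, Matrix.mulVec_diagonal]
  exact Finset.sum_congr rfl fun i _ => by ring

/-- Over `ℚ_p` with `p` odd, quadratic forms in at least five variables are isotropic: among five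
diagonal coefficients, three have valuations of the same parity. -/
theorem exists_isotropic_of_five_le_finrank (hp : p ≠ 2) {V : Type*} [AddCommGroup V]
    [Module ℚ_[p] V] [FiniteDimensional ℚ_[p] V] (Q : QuadraticForm ℚ_[p] V)
    (hd : 5 ≤ Module.finrank ℚ_[p] V) : ∃ x : V, x ≠ 0 ∧ Q x = 0 := by
  have : Invertible (2 : ℚ_[p]) := invertibleOfNonzero two_ne_zero
  obtain ⟨w, ⟨e⟩⟩ := QuadraticForm.equivalent_weightedSumSquares Q
  suffices h : ∃ y : Fin (Module.finrank ℚ_[p] V) → ℚ_[p], y ≠ 0 ∧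
      QuadraticMap.weightedSumSquares ℚ_[p] w y = 0 by
    obtain ⟨y, hy0, hy⟩ := h
    refine ⟨e.symm y, fun h0 => hy0 ?_, by rw [e.symm.map_app, hy]⟩
    rw [← e.apply_symm_apply y, h0, map_zero]
  simp only [QuadraticMap.weightedSumSquares_apply, smul_eq_mul]
  by_cases hw : ∃ i, w i = 0
  · obtain ⟨i, hi⟩ := hw
    refine ⟨Pi.single i 1, fun h => one_ne_zero (α := ℚ_[p]) (by simpa using congrFun h i), ?_⟩
    refine Finset.sum_eq_zero fun j _ => ?_
    by_cases hj : j = i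
    · subst hj; rw [hi, zero_mul]
    · simp [hj]
  push Not at hw
  choose ε a u ha hu using fun i => exists_unit_mul_sq (hw i)
  -- three of the coefficients agree up to units and squares
  obtain ⟨e0, he0⟩ := Fintype.exists_lt_card_fiber_of_mul_lt_card (f := ε) (n := 2)
    (by rw [Fintype.card_fin, Fintype.card_fin]; omega)
  obtain ⟨idx⟩ : Nonempty (Fin 3 ↪ {i // ε i = e0}) :=
    Function.Embedding.nonempty_of_card_le (by
      rw [Fintype.card_fin, Fintype.card_subtype]; exact he0)
  obtain ⟨x, hx0, hx⟩ := exists_isotropic_three hp fun s => u (idx s)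
  have hinj : Function.Injective fun s => (idx s : Fin (Module.finrank ℚ_[p] V)) :=
    Subtype.val_injective.comp idx.injective
  let z : Fin 3 → ℚ_[p] := fun s => x s * (a (idx s))⁻¹
  refine ⟨Function.extend (fun s => (idx s : Fin (Module.finrank ℚ_[p] V))) z 0,
    fun h0 => hx0 ?_, ?_⟩
  · funext s
    have h1 := congrFun h0 (idx s)
    rw [hinj.extend_apply] at h1
    simpa [z, ha] using h1
  · have hx' : ∑ s, ((u (idx s) : ℤ_[p]) : ℚ_[p]) * (x s : ℚ_[p]) ^ 2 = 0 := by
      have h1 := congrArg (fun y : ℤ_[p] => (y : ℚ_[p])) hx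
      push_cast at h1
      exact h1
    calc _ = ∑ s, (p : ℚ_[p]) ^ (e0 : ℕ) * (((u (idx s) : ℤ_[p]) : ℚ_[p]) * (x s : ℚ_[p]) ^ 2) := by
          refine (Fintype.sum_of_injective _ hinj _ _ (fun i hi => ?_) (fun s => ?_)).symm
          · rw [Function.extend_apply' _ _ _ fun ⟨s, hs⟩ => hi ⟨s, hs⟩]
            simp
          · rw [hinj.extend_apply, hu, (idx s).2]
            have := ha (idx s)
            simp only [z]
            field_simp
      _ = 0 := by rw [← Finset.mul_sum, hx', mul_zero]

end Padic

/-! ### Isotropy of rational subspaces -/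

section Lattice

variable {n : ℕ} {M : Matrix (Fin n) (Fin n) ℤ}

/-- The coordinates of a `ℤ`-basis of `L(ℤ)`, as the rows of a matrix. -/
def latticeMatrix (L : Submodule ℚ (Fin n → ℚ)) :
    Matrix (Fin (Module.finrank ℤ (intPoints L))) (Fin n) ℤ :=
  Matrix.of fun i => (Module.finBasis ℤ (intPoints L) i : Fin n → ℤ)

theorem det_gram_latticeMatrix (M : Matrix (Fin n) (Fin n) ℤ) (L : Submodule ℚ (Fin n → ℚ)) :
    (latticeMatrix L * M * (latticeMatrix L)ᵀ).det = disc M L := by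
  rw [disc]
  congr 1
  ext i j
  rw [Matrix.mul_assoc]
  rfl

/-- Every vector of `L` is a rational multiple of a vector of `L(ℤ)`. -/
theorem exists_smul_eq_of_mem {L : Submodule ℚ (Fin n → ℚ)} {x : Fin n → ℚ} (hx : x ∈ L) :
    ∃ d : ℤ, d ≠ 0 ∧ ∃ z ∈ intPoints L, ∀ i, (d : ℚ) * x i = z i := by
  obtain ⟨d, hd⟩ := IsLocalization.exist_integer_multiples_of_finite (nonZeroDivisors ℤ) x
  choose z hz using hd
  have hz' : ∀ i, ((d : ℤ) : ℚ) * x i = z i := fun i => by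
    have h1 := hz i
    rw [Algebra.smul_def] at h1
    exact h1.symm
  refine ⟨d, nonZeroDivisors.ne_zero d.2, z, ?_, hz'⟩
  have e : ((Algebra.linearMap ℤ ℚ).compLeft (Fin n)) z = ((d : ℤ) : ℚ) • x :=
    funext fun i => (hz' i).symm
  change ((Algebra.linearMap ℤ ℚ).compLeft (Fin n)) z ∈ L
  rw [e]
  exact L.smul_mem _ hx

theorem intCast_mem_of_mem_intPoints {L : Submodule ℚ (Fin n → ℚ)} {z : Fin n → ℤ}
    (hz : z ∈ intPoints L) : (fun i => (z i : ℚ)) ∈ L := hz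

/-- The rows of the lattice matrix span `L` over `ℚ`. -/
theorem span_latticeMatrix (L : Submodule ℚ (Fin n → ℚ)) :
    Submodule.span ℚ (Set.range fun i k => (latticeMatrix L i k : ℚ)) = L := by
  refine le_antisymm (Submodule.span_le.2 ?_) fun x hx => ?_
  · rintro _ ⟨i, rfl⟩
    exact intCast_mem_of_mem_intPoints (Module.finBasis ℤ (intPoints L) i).2
  · obtain ⟨d, hd, z, hz, hzx⟩ := exists_smul_eq_of_mem hx
    have h1 : (fun i => (z i : ℚ)) ∈
        Submodule.span ℚ (Set.range fun i k => (latticeMatrix L i k : ℚ)) := by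
      obtain ⟨r, hr⟩ : ∃ r : Fin (Module.finrank ℤ (intPoints L)) → ℤ,
          ∑ i, r i • Module.finBasis ℤ (intPoints L) i = ⟨z, hz⟩ :=
        ⟨_, (Module.finBasis ℤ (intPoints L)).sum_repr ⟨z, hz⟩⟩
      have h3 : (fun k => (z k : ℚ)) = ∑ i, (r i : ℚ) • fun k => (latticeMatrix L i k : ℚ) := by
        funext k
        have h4 : _ = z k := congrFun (congrArg Subtype.val hr) k
        rw [← h4]
        simp [latticeMatrix, Finset.sum_apply]
      rw [h3]
      exact Submodule.sum_mem _ fun i _ => Submodule.smul_mem _ _ (Submodule.subset_span ⟨i, rfl⟩)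
    have h2 : x = (d : ℚ)⁻¹ • fun i => (z i : ℚ) := by
      funext i
      rw [Pi.smul_apply, ← hzx, smul_eq_mul, inv_mul_cancel_left₀ (Int.cast_ne_zero.2 hd)]
    rw [h2]
    exact Submodule.smul_mem _ _ h1

theorem linearIndependent_latticeMatrix (L : Submodule ℚ (Fin n → ℚ)) :
    LinearIndependent ℚ fun i k => (latticeMatrix L i k : ℚ) := by
  have h1 : LinearIndependent ℤ fun i => latticeMatrix L i :=
    (Module.finBasis ℤ (intPoints L)).linearIndependent.map' (intPoints L).subtype
      (Submodule.ker_subtype _)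
  have h2 : LinearIndependent ℤ fun i k => (latticeMatrix L i k : ℚ) :=
    h1.map' ((Algebra.linearMap ℤ ℚ).compLeft (Fin n)) (LinearMap.ker_eq_bot.2 fun x y h =>
      funext fun i => Int.cast_injective (congrFun h i))
  exact (LinearIndependent.iff_fractionRing ℤ ℚ).1 h2

theorem finrank_intPoints (L : Submodule ℚ (Fin n → ℚ)) :
    Module.finrank ℤ (intPoints L) = Module.finrank ℚ L := by
  rw [← Fintype.card_fin (Module.finrank ℤ (intPoints L)),
    ← finrank_span_eq_card (linearIndependent_latticeMatrix L), span_latticeMatrix]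

theorem gram_isSymm {R κ : Type*} [CommRing R] {M : Matrix (Fin n) (Fin n) R} (hM : M.IsSymm)
    (B : Matrix κ (Fin n) R) : (B * M * Bᵀ).IsSymm := by
  rw [Matrix.IsSymm, Matrix.transpose_mul, Matrix.transpose_mul, Matrix.transpose_transpose, hM,
    Matrix.mul_assoc]

theorem vecMul_dotProduct_mulVec_vecMul {R κ : Type*} [Fintype κ] [CommRing R]
    (M : Matrix (Fin n) (Fin n) R) (B : Matrix κ (Fin n) R) (x y : κ → R) :
    (x ᵥ* B) ⬝ᵥ (M *ᵥ (y ᵥ* B)) = x ⬝ᵥ ((B * M * Bᵀ) *ᵥ y) := by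
  rw [← Matrix.mulVec_transpose B y, Matrix.mulVec_mulVec, ← Matrix.dotProduct_mulVec,
    Matrix.mulVec_mulVec, Matrix.mul_assoc]

variable {p : ℕ} [Fact p.Prime]

theorem form_padicInt_coe (v : Fin n → ℤ_[p]) :
    form M ℚ_[p] (fun i => (v i : ℚ_[p])) =
      ((v ⬝ᵥ (M.map (Int.cast : ℤ → ℤ_[p]) *ᵥ v) : ℤ_[p]) : ℚ_[p]) := by
  rw [form_apply]
  simp [dotProduct, mulVec]

theorem isUnit_intCast_padicInt {z : ℤ} (hz : ¬ (p : ℤ) ∣ z) : IsUnit (z : ℤ_[p]) := by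
  rw [PadicInt.isUnit_iff]
  exact le_antisymm (PadicInt.norm_le_one _)
    (not_lt.1 fun h => hz ((PadicInt.norm_int_lt_one_iff_dvd z).1 h))

theorem isUnit_det_gram {L : Submodule ℚ (Fin n → ℚ)} (hdisc : ¬ (p : ℤ) ∣ disc M L) :
    IsUnit ((latticeMatrix L).map (Int.cast : ℤ → ℤ_[p]) * M.map (Int.cast : ℤ → ℤ_[p]) *
      ((latticeMatrix L).map (Int.cast : ℤ → ℤ_[p]))ᵀ).det := by
  have e : (latticeMatrix L).map (Int.cast : ℤ → ℤ_[p]) * M.map (Int.cast : ℤ → ℤ_[p]) *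
      ((latticeMatrix L).map (Int.cast : ℤ → ℤ_[p]))ᵀ =
        (latticeMatrix L * M * (latticeMatrix L)ᵀ).map (Int.cast : ℤ → ℤ_[p]) := by
    have h := fun {l m o : Type} [Fintype m] (A : Matrix l m ℤ) (B : Matrix m o ℤ) =>
      Matrix.map_mul (L := A) (M := B) (f := Int.castRingHom ℤ_[p])
    simp only [Int.coe_castRingHom] at h
    rw [h, h, Matrix.transpose_map]
  rw [e, ← Int.cast_det, det_gram_latticeMatrix]
  exact isUnit_intCast_padicInt hdisc

/-- If `p` does not divide the discriminant of `L`, then `L` is isotropic over `ℚ_p`. -/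
theorem exists_isotropic_of_not_dvd_disc (hp : p ≠ 2) (hM : M.IsSymm)
    {L : Submodule ℚ (Fin n → ℚ)} (hd : 3 ≤ Module.finrank ℚ L) (hdisc : ¬ (p : ℤ) ∣ disc M L) :
    ∃ u ∈ extend ℚ_[p] L, u ≠ 0 ∧ form M ℚ_[p] u = 0 := by
  rw [← finrank_intPoints] at hd
  set B := (latticeMatrix L).map (Int.cast : ℤ → ℤ_[p]) with hB
  set M' := M.map (Int.cast : ℤ → ℤ_[p]) with hM'
  have hMs : M'.IsSymm := by rw [Matrix.IsSymm, hM', ← Matrix.transpose_map, hM]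
  have hG : IsUnit (B * M' * Bᵀ).det := isUnit_det_gram hdisc
  obtain ⟨x, hx0, hx⟩ := exists_isotropic_of_unimodular hp hd (gram_isSymm hMs B) (by
    rintro x ⟨i, hi⟩
    refine ⟨(B * M' * Bᵀ)⁻¹ *ᵥ Pi.single i 1, ?_⟩
    rw [Matrix.mulVec_mulVec, Matrix.mul_nonsing_inv _ hG, Matrix.one_mulVec, dotProduct_single,
      mul_one]
    exact hi)
  have e : (fun k => (((x ᵥ* B) k : ℤ_[p]) : ℚ_[p])) = ∑ i, (x i : ℚ_[p]) •
      vecMap n ℚ ℚ_[p] (fun k => (latticeMatrix L i k : ℚ)) := by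
    funext k
    simp [Matrix.vecMul, dotProduct, vecMap, hB, Finset.sum_apply]
  refine ⟨fun k => (((x ᵥ* B) k : ℤ_[p]) : ℚ_[p]), ?_, fun h0 => hx0 ?_, ?_⟩
  · rw [e]
    refine Submodule.sum_mem _ fun i _ => Submodule.smul_mem _ _ (vecMap_mem_extend _ ?_)
    exact intCast_mem_of_mem_intPoints (Module.finBasis ℤ (intPoints L) i).2
  · rw [e] at h0
    have hli := linearIndependent_vecMap (K := ℚ_[p]) (linearIndependent_latticeMatrix L)
    have h1 := Fintype.linearIndependent_iff.1 hli (fun i => (x i : ℚ_[p])) h0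
    exact funext fun i => Subtype.ext (h1 i)
  · rw [form_padicInt_coe, vecMul_dotProduct_mulVec_vecMul, hx, PadicInt.coe_zero]

theorem exists_isotropic_extend_of_five_le (hp : p ≠ 2) {L : Submodule ℚ (Fin n → ℚ)}
    (hd : 5 ≤ Module.finrank ℚ L) : ∃ u ∈ extend ℚ_[p] L, u ≠ 0 ∧ form M ℚ_[p] u = 0 := by
  obtain ⟨x, hx0, hx⟩ := exists_isotropic_of_five_le_finrank hp
    ((form M ℚ_[p]).comp (extend ℚ_[p] L).subtype) (hd.trans (finrank_le_finrank_extend ℚ_[p] L))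
  exact ⟨x, x.2, fun h => hx0 (Subtype.ext h), hx⟩

/-- If `p` divides neither the discriminant of `L` nor the determinant of the ambient form, then the
orthogonal complement of `L` is isotropic over `ℚ_p`: the vectors of `ℤ_pⁿ` orthogonal to `L` form a
unimodular lattice. -/
theorem exists_isotropic_orthogonal (hp : p ≠ 2) (hM : M.IsSymm) (hM0 : M.det ≠ 0)
    {L L' : Submodule ℚ (Fin n → ℚ)}
    (ho : ∀ x ∈ L, ∀ y ∈ L', QuadraticMap.polar (form M ℚ) x y = 0) (ht : L ⊔ L' = ⊤)
    (hd : 3 ≤ n - Module.finrank ℚ L) (hdisc : ¬ (p : ℤ) ∣ disc M L) (hdet : ¬ (p : ℤ) ∣ M.det) :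
    ∃ u ∈ extend ℚ_[p] L', u ≠ 0 ∧ form M ℚ_[p] u = 0 := by
  rw [← finrank_intPoints] at hd
  set B := (latticeMatrix L).map (Int.cast : ℤ → ℤ_[p]) with hB
  set M' := M.map (Int.cast : ℤ → ℤ_[p]) with hM'
  have hMs : M'.IsSymm := by rw [Matrix.IsSymm, hM', ← Matrix.transpose_map, hM]
  have hG : IsUnit (B * M' * Bᵀ).det := isUnit_det_gram hdisc
  have hMu : IsUnit M'.det := by
    rw [hM', ← Int.cast_det]
    exact isUnit_intCast_padicInt hdet
  let T : (Fin n → ℤ_[p]) →ₗ[ℤ_[p]] (Fin (Module.finrank ℤ (intPoints L)) → ℤ_[p]) :=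
    (B * M').mulVecLin
  let N := LinearMap.ker T
  let c := Module.finBasis ℤ_[p] N
  have hs : 3 ≤ Module.finrank ℤ_[p] N := by
    have h1 := Submodule.finrank_quotient_add_finrank (LinearMap.ker T)
    rw [T.quotKerEquivRange.finrank_eq] at h1
    have h2 : Module.finrank ℤ_[p] (LinearMap.range T) ≤ Module.finrank ℤ (intPoints L) := by
      simpa using Submodule.finrank_le (LinearMap.range T)
    rw [Module.finrank_fin_fun] at h1
    change 3 ≤ Module.finrank ℤ_[p] (LinearMap.ker T)
    omega
  let C : Matrix (Fin (Module.finrank ℤ_[p] N)) (Fin n) ℤ_[p] := Matrix.of fun i => (c i).1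
  have hC : ∀ x, x ᵥ* C = (c.equivFun.symm x).1 := by
    intro x
    rw [Module.Basis.equivFun_symm_apply]
    funext k
    simp [Matrix.vecMul, dotProduct, C, Finset.sum_apply]
  have hCT : ∀ v ∈ N, ∃ x, x ᵥ* C = v := fun v hv =>
    ⟨c.equivFun ⟨v, hv⟩, by rw [hC, LinearEquiv.symm_apply_apply]⟩
  have hCinj : ∀ x y, x ᵥ* C = y ᵥ* C → x = y := fun x y h => by
    rw [hC, hC] at h
    exact c.equivFun.symm.injective (Subtype.ext h)
  obtain ⟨x, hx0, hx⟩ := exists_isotropic_of_unimodular hp hs (gram_isSymm hMs C) (by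
    rintro x ⟨i, hi⟩
    have hv : x ᵥ* C ∈ N := by rw [hC]; exact Subtype.mem _
    obtain ⟨l, hl⟩ : ∃ l, IsUnit ((x ᵥ* C) l) := by
      -- otherwise `x ᵥ* C`, hence `x`, would be divisible by `p`
      by_contra! h
      have hdvd : ∀ l, ∃ w, (x ᵥ* C) l = p * w := fun l => by
        have h1 := PadicInt.mem_nonunits.1 (h l)
        exact (PadicInt.norm_lt_one_iff_dvd _).1 h1
      choose w hw using hdvd
      have hw' : x ᵥ* C = (p : ℤ_[p]) • w := funext hw
      have hp0 : (p : ℤ_[p]) ≠ 0 := Nat.cast_ne_zero.2 (Fact.out : p.Prime).ne_zero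
      have hwN : w ∈ N := by
        have h1 : T (x ᵥ* C) = 0 := hv
        rw [hw', map_smul] at h1
        exact (smul_eq_zero.1 h1).resolve_left hp0
      obtain ⟨y, rfl⟩ := hCT w hwN
      rw [← Matrix.smul_vecMul] at hw'
      rw [hCinj _ _ hw', Pi.smul_apply, smul_eq_mul] at hi
      exact PadicInt.p_nonunit (isUnit_of_mul_isUnit_left hi)
    -- `z` pairs to a unit with `x ᵥ* C`; subtract its projection to the lattice of `L`
    obtain ⟨z, hzv⟩ : ∃ z, (x ᵥ* C) ⬝ᵥ (M' *ᵥ z) = (x ᵥ* C) l := by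
      refine ⟨M'⁻¹ *ᵥ Pi.single l 1, ?_⟩
      rw [Matrix.mulVec_mulVec, Matrix.mul_nonsing_inv _ hMu, Matrix.one_mulVec,
        dotProduct_single, mul_one]
    set r := (B * M' * Bᵀ)⁻¹ *ᵥ ((B * M') *ᵥ z) with hr
    have hyN : z - r ᵥ* B ∈ N := by
      change (B * M') *ᵥ (z - r ᵥ* B) = 0
      have h1 : (B * M') *ᵥ (r ᵥ* B) = (B * M') *ᵥ z := by
        rw [← Matrix.mulVec_transpose, Matrix.mulVec_mulVec, hr, Matrix.mulVec_mulVec,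
          Matrix.mul_nonsing_inv _ hG, Matrix.one_mulVec]
      rw [Matrix.mulVec_sub, h1, sub_self]
    obtain ⟨y, hy⟩ := hCT _ hyN
    refine ⟨y, ?_⟩
    rw [← vecMul_dotProduct_mulVec_vecMul, hy, Matrix.mulVec_sub, dotProduct_sub, hzv]
    have h0 : (x ᵥ* C) ⬝ᵥ (M' *ᵥ (r ᵥ* B)) = 0 := by
      have h1 : (B * M') *ᵥ (x ᵥ* C) = 0 := hv
      rw [← Matrix.mulVec_transpose B r, Matrix.mulVec_mulVec, Matrix.dotProduct_mulVec,
        ← Matrix.mulVec_transpose, Matrix.transpose_mul, Matrix.transpose_transpose, hMs.eq, h1,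
        zero_dotProduct]
    rw [h0, sub_zero]
    exact hl)
  have hv : x ᵥ* C ∈ N := by rw [hC]; exact Subtype.mem _
  refine ⟨fun k => (((x ᵥ* C) k : ℤ_[p]) : ℚ_[p]), ?_, fun h0 => hx0 ?_, ?_⟩
  · refine mem_of_forall_polar_eq_zero (W' := extend ℚ_[p] L)
      (fun v => eq_zero_of_forall_polar_form_eq_zero hM hM0 ℚ_[p])
      (extend_orthogonal ℚ_[p] fun x hx y hy =>
        (QuadraticMap.polar_comm _ _ _).trans (ho y hy x hx))
      (by rw [sup_comm]; exact extend_sup_eq_top ℚ_[p] ht) fun y hy => ?_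
    let W := LinearMap.ker (QuadraticMap.polarBilin (form M ℚ_[p]) fun k => ((x ᵥ* C) k : ℚ_[p]))
    have hLW : L ≤ (W.restrictScalars ℚ).comap (vecMap n ℚ ℚ_[p]) := by
      conv_lhs => rw [← span_latticeMatrix L]
      refine Submodule.span_le.2 ?_
      rintro _ ⟨i, rfl⟩
      change QuadraticMap.polar _ _ _ = 0
      have h1 : (B * M') *ᵥ (x ᵥ* C) = 0 := hv
      rw [← Matrix.mulVec_mulVec] at h1
      have h2 := congrArg (fun z : ℤ_[p] => (z : ℚ_[p])) (congrFun h1 i)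
      rw [QuadraticMap.polar_comm, polar_form hM]
      refine mul_eq_zero_of_right _ (Eq.trans ?_ h2)
      simp [vecMap, Matrix.mulVec, dotProduct, hB, hM']
    have h1 : extend ℚ_[p] L ≤ W := Submodule.span_le.2 (Set.image_subset_iff.2 hLW)
    exact h1 hy
  · refine hCinj _ _ ?_
    rw [Matrix.zero_vecMul]
    exact funext fun k => Subtype.ext (congrFun h0 k)
  · rw [form_padicInt_coe, vecMul_dotProduct_mulVec_vecMul, hx, PadicInt.coe_zero]

end Lattice

end RationalPlane

end

theorem mainTheorem7 (n k : ℕ) (hk : 3 ≤ k) (hnk : 3 ≤ n - k)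
    (M : Matrix (Fin n) (Fin n) ℤ) (hM : (M.map (Int.cast : ℤ → ℝ)).PosDef)
    (L : Submodule ℚ (Fin n → ℚ)) (hL : Module.finrank ℚ L = k)
    (p : ℕ) [Fact p.Prime] (hp : p ≠ 2)
    (h : (¬ (p : ℤ) ∣ RationalPlane.disc M L ∧ (5 ≤ n - k ∨ ¬ (p : ℤ) ∣ M.det)) ∨
      (5 ≤ k ∧ 5 ≤ n - k)) :
    RationalPlane.StronglyIsotropicAt p
      (RationalPlane.groupH M L (AlgebraicClosure ℚ_[p])) := by
  have hsymm : M.IsSymm := by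
    ext i j
    have h1 := congrFun (congrFun hM.isHermitian i) j
    simpa using h1
  have hdet : M.det ≠ 0 := by
    have h1 := hM.det_pos.ne'
    rw [← Int.cast_det] at h1
    exact Int.cast_ne_zero.1 h1
  have hpos : ∀ x : Fin n → ℚ, x ≠ 0 → RationalPlane.form M ℚ x ≠ 0 := by
    intro x hx h0
    have h1 := hM.toQuadraticForm' (RationalPlane.vecMap n ℚ ℝ x)
      (fun h => hx (RationalPlane.vecMap_injective n ℚ ℝ (h.trans (map_zero _).symm)))
    have h2 := RationalPlane.form_vecMap M (K := ℝ) x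
    rw [h0, map_zero] at h2
    exact h1.ne' h2
  let P : LinearMap.BilinForm ℚ (Fin n → ℚ) := QuadraticMap.polarBilin (RationalPlane.form M ℚ)
  have hrefl : P.IsRefl := fun x y hxy =>
    (QuadraticMap.polar_comm _ _ _).trans hxy
  let L' := P.orthogonal L
  have ho : ∀ x ∈ L, ∀ y ∈ L', QuadraticMap.polar (RationalPlane.form M ℚ) x y = 0 :=
    fun x hx y hy => hy x hx
  have hcompl : IsCompl L L' := by
    refine (LinearMap.BilinForm.isCompl_orthogonal_iff_disjoint hrefl).2 ?_
    rw [Submodule.disjoint_def]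
    intro x hx hx'
    by_contra hx0
    have h1 := ho x hx x hx'
    rw [QuadraticMap.polar_self] at h1
    exact hpos x hx0 (by simpa using h1)
  have hfin : Module.finrank ℚ L' = n - k := by
    have h1 := Submodule.finrank_add_eq_of_isCompl hcompl
    rw [Module.finrank_fin_fun, hL] at h1
    omega
  refine RationalPlane.stronglyIsotropicAt_of_isotropic hsymm hdet ho hcompl.sup_eq_top (hL ▸ hk)
    (hfin ▸ hnk) ?_ ?_
  · rcases h with ⟨h1, -⟩ | ⟨h1, -⟩
    · exact RationalPlane.exists_isotropic_of_not_dvd_disc hp hsymm (hL ▸ hk) h1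
    · exact RationalPlane.exists_isotropic_extend_of_five_le hp (hL ▸ h1)
  · rcases h with ⟨h1, h2 | h2⟩ | ⟨-, h2⟩
    · exact RationalPlane.exists_isotropic_extend_of_five_le hp (hfin ▸ h2)
    · exact RationalPlane.exists_isotropic_orthogonal hp hsymm hdet ho hcompl.sup_eq_top
        (hL ▸ hnk) h1 h2
    · exact RationalPlane.exists_isotropic_extend_of_five_le hp (hfin ▸ h2)
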